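/- \textbf{Setting.} Let $\tau:E\to M$ and $\tau':E'\to M'$ be Lie algebroids (finite rank, over finite-dimensional Hausdorff manifolds, everything $C^\infty$) with anchors $\rho,\rho'$. For $a\in E$ let $\mathcal T^E_aE=\{(b,v)\in E_{\tau(a)}\times T_aE:\rho(b)=T_a\tau(v)\}$; these are the fibres of the prolongation Lie algebroid $\mathcal T^EE\to E$, with anchor $\rho^1(b,v)=v$ and bracket $[(\sigma_1,X_1),(\sigma_2,X_2)]=([\sigma_1,\sigma_2],[X_1,X_2])$ on projectable sections. Let $b_a^V\in T_aE$ be the velocity of $t\mapsto a+tb$ at $t=0$, $S(b,v)=(0,b_a^V)$ the vertical endomorphism and $\Delta(a)=(0,a_a^V)$ the Liouville section. For $L\in C^\infty(E)$ put $\theta_L=S^*(dL)$, $\omega_L=-d\theta_L$, $E_L=d_\Delta L-L$, where $d$ is the differential of $\mathcal T^EE$. A \emph{constrained Lagrangian system} $(L,D)$ on $E$ consists of $L\in C^\infty(E)$ and a smooth vector subbundle $D\subseteq E$ over $M$. For $a\in D$ let $\mathcal T^D_aD=\{(b,v)\in\mathcal T^E_aE: b\in D,\ v\in T_aD\}$.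 The system is \emph{regular} if $\omega_L$ is nondegenerate along (hence near) $D$ and if at every point $a\in D$ the Lagrange--d'Alembert equations have a unique solution, i.e. there is exactly one $z\in\mathcal T^D_aD$ such that $Sz=\Delta(a)$ and $\omega_L(z,u)-\langle dE_L,u\rangle=\langle\lambda,b\rangle$ for all $u=(b,v)\in\mathcal T^E_aE$ and some $\lambda\in(E_{\tau(a)})^*$ that vanishes on $D_{\tau(a)}$. In that case $\mathcal T^E_aE=\mathcal T^D_aD\oplus(\mathcal T^D_aD)^{\perp}$ for $a\in D$ (orthogonal with respect to $\omega_L$); let $\bar P$ be the projector onto the first summand. The \emph{nonholonomic bracket} of $f,g\in C^\infty(D)$ is the function on $D$ $$\{f,g\}_{nh}=\omega_L(\bar P(X_{f}),\bar P(X_{g})),\qquad i_{X_f}\omega_L=df,\quad i_{X_g}\omega_L=dg,$$ where $f,g$ on the right are replaced by arbitrary smooth extensions to $E$, on which the result does not depend. \textbf{Theorem.} Let $(L,D)$ be a regular constrained Lagrangian system on $E$ and $(L',D')$ a constrained Lagrangian system on $E'$. Let $\Phi:E\to E'$ be a fibrewise surjective morphism of Lie algebroids over $\varphi:M\to M'$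 such that $L=L'\circ\Phi$ and such that $\Phi$ maps the bundle $D$ onto $D'$, i.e. $\varphi$ is surjective and $\Phi(D_m)=D'_{\varphi(m)}$ for every $m\in M$. Then $(L',D')$ is regular too, and the nonholonomic brackets of the two systems satisfy $$\{f'\circ\Phi,\ g'\circ\Phi\}_{nh}=\{f',g'\}'_{nh}\circ\Phi\quad\text{on } D,\qquad\text{for all } f',g'\in C^\infty(D').$$ That is, $\Phi:D\to D'$ is a morphism of the almost-Poisson nonholonomic brackets. -/

import Mathlib

open Bundle Set Filter VectorField
open scoped Manifold ContDiff Topology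

noncomputable section

/-- The derivative `v(f)` of a vector-valued function `f` along a tangent vector `v` at `x`. -/
def dirDeriv {H : Type*} [TopologicalSpace H] {V : Type*} [NormedAddCommGroup V]
    [NormedSpace ℝ V] (I : ModelWithCorners ℝ V H) {M : Type*} [TopologicalSpace M]
    [ChartedSpace H M] {G : Type*} [NormedAddCommGroup G] [NormedSpace ℝ G]
    (f : M → G) (x : M) (v : TangentSpace I x) : G :=
  mfderiv I 𝓘(ℝ, G) f x v

/-- The Lie bracket of vector fields acts on functions as the commutator. -/
theorem dirDeriv_mlieBracket
    {H : Type*} [TopologicalSpace H] {V : Type*} [NormedAddCommGroup V] [NormedSpace ℝ V]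
    [CompleteSpace V] {I : ModelWithCorners ℝ V H} [I.Boundaryless]
    {M : Type*} [TopologicalSpace M] [ChartedSpace H M] [IsManifold I ∞ M]
    {G : Type*} [NormedAddCommGroup G] [NormedSpace ℝ G]
    {f : M → G} {x : M} {X Y : Π y : M, TangentSpace I y}
    (hf : ContMDiffAt I 𝓘(ℝ, G) ∞ f x)
    (hX : ContMDiff I I.tangent ∞ (fun y => (⟨y, X y⟩ : TangentBundle I M)))
    (hY : ContMDiff I I.tangent ∞ (fun y => (⟨y, Y y⟩ : TangentBundle I M))) :
    dirDeriv I f x (mlieBracket I X Y x) =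
      dirDeriv I (fun y => dirDeriv I f y (Y y)) x (X x) -
        dirDeriv I (fun y => dirDeriv I f y (X y)) x (Y x) := by
  have : IsManifold I 2 M := inferInstance
  have : IsManifold I 1 M := inferInstance
  set φ := extChartAt I x with hφ
  have hr : range I = univ := I.range_eq_univ
  -- near x̂, φ.symm is differentiable and a right inverse
  have hx : x ∈ φ.source := mem_extChartAt_source x
  have key : ∀ᶠ z in 𝓝 (φ x), z ∈ φ.target :=
    extChartAt_target_mem_nhds (I := I) x
  have hs : ∀ z ∈ φ.target, MDifferentiableAt 𝓘(ℝ, V) I φ.symm z := by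
    intro z hz
    have := (contMDiffOn_extChartAt_symm (I := I) (n := 1) x) z hz
    exact (this.contMDiffAt ((isOpen_extChartAt_target x).mem_nhds hz)).mdifferentiableAt one_ne_zero
  have hinv : ∀ z ∈ φ.target, (mfderiv 𝓘(ℝ, V) I φ.symm z).IsInvertible := by
    intro z hz
    have := isInvertible_mfderivWithin_extChartAt_symm (I := I) (x := x) (y := z) hz
    rwa [hr, mfderivWithin_univ] at this
  have hrel : ∀ (Z : Π y : M, TangentSpace I y), ∀ z ∈ φ.target,
      mfderiv 𝓘(ℝ, V) I φ.symm z (mpullback 𝓘(ℝ, V) I φ.symm Z z) = Z (φ.symm z) := by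
    intro Z z hz
    exact (hinv z hz).self_apply_inverse _
  have hdiff : ∀ (Z : Π y : M, TangentSpace I y),
      ContMDiff I I.tangent ∞ (fun y => (⟨y, Z y⟩ : TangentBundle I M)) →
      DifferentiableAt ℝ (mpullback 𝓘(ℝ, V) I φ.symm Z : V → V) (φ x) := by
    intro Z hZ
    have := MDifferentiableWithinAt.differentiableWithinAt_mpullbackWithin_vectorField
      (I := I) (s := univ) (x := x) (V := Z)
      ((hZ x).mdifferentiableAt (by simp)).mdifferentiableWithinAt
    rw [hr, preimage_univ, univ_inter, mpullbackWithin_univ] at this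
    exact differentiableWithinAt_univ.1 this
  have hfe : ∀ᶠ z in 𝓝 (φ x), MDifferentiableAt I 𝓘(ℝ, G) f (φ.symm z) := by
    have h1 : ∀ᶠ y in 𝓝 x, MDifferentiableAt I 𝓘(ℝ, G) f y := by
      have h1 : ContMDiffAt I 𝓘(ℝ, G) 1 f x := hf.of_le (by simp)
      filter_upwards [(contMDiffAt_iff_contMDiffAt_nhds (by simp)).1 h1] with y hy
        using hy.mdifferentiableAt one_ne_zero
    have hc : ContinuousAt φ.symm (φ x) := continuousAt_extChartAt_symm x
    have : Tendsto φ.symm (𝓝 (φ x)) (𝓝 x) := by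
      have h := hc.tendsto
      rwa [φ.left_inv hx] at h
    exact this.eventually h1
  -- the chart expression of `d f (Z)`
  have hloc : ∀ (Z : Π y : M, TangentSpace I y),
      (fun z => dirDeriv I f (φ.symm z) (Z (φ.symm z))) =ᶠ[𝓝 (φ x)]
      fun z => fderiv ℝ (f ∘ φ.symm) z (mpullback 𝓘(ℝ, V) I φ.symm Z z : V) := by
    intro Z
    filter_upwards [key, hfe] with z hz hfz
    rw [← mfderiv_eq_fderiv, mfderiv_comp z hfz (hs z hz)]
    exact (congrArg (mfderiv I 𝓘(ℝ, G) f (φ.symm z)) (hrel Z z hz)).symm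
  have hfh : ContDiffAt ℝ ∞ (f ∘ φ.symm) (φ x) := by
    rw [← contMDiffAt_iff_contDiffAt]
    have h1 : ContMDiffAt 𝓘(ℝ, V) I ∞ φ.symm (φ x) :=
      ((contMDiffOn_extChartAt_symm (I := I) (n := ∞) x) _ (mem_extChartAt_target x)).contMDiffAt
        (extChartAt_target_mem_nhds x)
    refine ContMDiffAt.comp (φ x) ?_ h1
    rwa [φ.left_inv hx]
  have hfd : ∀ (Z : Π y : M, TangentSpace I y),
      ContMDiff I I.tangent ∞ (fun y => (⟨y, Z y⟩ : TangentBundle I M)) →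
      DifferentiableAt ℝ
        (fun z => fderiv ℝ (f ∘ φ.symm) z (mpullback 𝓘(ℝ, V) I φ.symm Z z : V)) (φ x) := by
    intro Z hZ
    refine DifferentiableAt.clm_apply ?_ (hdiff Z hZ)
    exact (hfh.fderiv_right (m := 1) (WithTop.coe_le_coe.2 (le_top : (2 : ℕ∞) ≤ ⊤))).differentiableAt one_ne_zero
  have hφd : MDifferentiableAt I 𝓘(ℝ, V) φ x := mdifferentiableAt_extChartAt (mem_chart_source H x)
  have hcomp : ∀ w : V, (mfderiv I 𝓘(ℝ, V) φ x (mfderiv 𝓘(ℝ, V) I φ.symm (φ x) w) : V) = w := by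
    intro w
    have h2 := mfderiv_extChartAt_comp_mfderivWithin_extChartAt_symm (I := I) (x := x)
      (mem_extChartAt_target x)
    rw [hr, mfderivWithin_univ, ← hφ, φ.left_inv hx] at h2
    exact congrArg (fun T => T w) h2
  have hpush : ∀ (Z : Π y : M, TangentSpace I y),
      mfderiv I 𝓘(ℝ, V) φ x (Z x) = mpullback 𝓘(ℝ, V) I φ.symm Z (φ x) := by
    intro Z
    have h1 := hrel Z (φ x) (mem_extChartAt_target x)
    rw [φ.left_inv hx] at h1
    rw [← h1]
    exact hcomp _
  have hback : ∀ (Z T : Π y : M, TangentSpace I y),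
      ContMDiff I I.tangent ∞ (fun y => (⟨y, Z y⟩ : TangentBundle I M)) →
      dirDeriv I (fun y => dirDeriv I f y (Z y)) x (T x) =
      fderiv ℝ (fun z => fderiv ℝ (f ∘ φ.symm) z (mpullback 𝓘(ℝ, V) I φ.symm Z z : V)) (φ x)
        (mpullback 𝓘(ℝ, V) I φ.symm T (φ x) : V) := by
    intro Z T hZ
    set h : V → G := fun z => fderiv ℝ (f ∘ φ.symm) z (mpullback 𝓘(ℝ, V) I φ.symm Z z : V) with hh
    have e1 : (fun y => dirDeriv I f y (Z y)) =ᶠ[𝓝 x] h ∘ φ := by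
      have hc : Tendsto φ (𝓝 x) (𝓝 (φ x)) := continuousAt_extChartAt x
      filter_upwards [hc.eventually (hloc Z), extChartAt_source_mem_nhds (I := I) x] with y hy hys
      rw [φ.left_inv hys] at hy
      exact hy
    rw [← hpush T, dirDeriv, e1.mfderiv_eq,
      mfderiv_comp x (hfd Z hZ).mdifferentiableAt hφd, mfderiv_eq_fderiv]
    rfl
  rw [hback Y X hY, hback X Y hX]
  refine Eq.trans ?_ (fderiv_apply_lieBracket (n := ∞) hfh
    (by rw [minSmoothness_of_isRCLikeNormedField]; exact WithTop.coe_le_coe.2 (le_top : (2 : ℕ∞) ≤ ⊤)) (hdiff Y hY) (hdiff X hX))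
  set w : V :=
    lieBracket ℝ (mpullback 𝓘(ℝ, V) I φ.symm X) (mpullback 𝓘(ℝ, V) I φ.symm Y) (φ x) with hw
  have h3 : mlieBracket I X Y x = mfderiv 𝓘(ℝ, V) I φ.symm (φ x) w := by
    rw [← mlieBracketWithin_univ, mlieBracketWithin_apply, hr, preimage_univ, univ_inter]
    rw [mpullbackWithin_univ, mpullbackWithin_univ]
    have hi := isInvertible_mfderiv_extChartAt (I := I) (x := x) hx
    refine (hi.inverse_apply_eq).2 ?_
    refine Eq.trans ?_ (hcomp w).symm
    rw [hw]
    exact congrFun (lieBracketWithin_univ (𝕜 := ℝ) (E := V)) _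
  rw [h3, ← mfderiv_eq_fderiv, mfderiv_comp (φ x) (hfe.self_of_nhds) (hs _ (mem_extChartAt_target x))]
  simp only [dirDeriv]
  rw [φ.left_inv hx]
  rfl

/-- The derivative of a smooth function along a smooth vector field is smooth. -/
theorem dirDeriv_smooth {H : Type*} [TopologicalSpace H] {V : Type*} [NormedAddCommGroup V]
    [NormedSpace ℝ V] {I : ModelWithCorners ℝ V H} {M : Type*} [TopologicalSpace M]
    [ChartedSpace H M] [IsManifold I ∞ M] {f : M → ℝ} (hf : ContMDiff I 𝓘(ℝ, ℝ) ∞ f)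
    {X : Π y : M, TangentSpace I y}
    (hX : ContMDiff I I.tangent ∞ (fun y => (⟨y, X y⟩ : TangentBundle I M))) :
    ContMDiff I 𝓘(ℝ, ℝ) ∞ (fun y => dirDeriv I f y (X y)) :=
  (contMDiff_snd_tangentBundle_modelSpace ℝ 𝓘(ℝ, ℝ)).comp
    ((hf.contMDiff_tangentMap (m := ∞) le_rfl).comp hX)

/-- Tangent vectors are separated by smooth functions. -/
theorem tangent_ext {n : ℕ} {M : Type*} [TopologicalSpace M]
    [ChartedSpace (EuclideanSpace ℝ (Fin n)) M] [T2Space M] [IsManifold (𝓡 n) ∞ M]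
    {x : M} {u v : TangentSpace (𝓡 n) x}
    (h : ∀ f : M → ℝ, ContMDiff (𝓡 n) 𝓘(ℝ, ℝ) ∞ f → dirDeriv (𝓡 n) f x u = dirDeriv (𝓡 n) f x v) :
    u = v := by
  obtain ⟨χ⟩ : Nonempty (SmoothBumpFunction (𝓡 n) x) := inferInstance
  set φ := extChartAt (𝓡 n) x with hφ
  have hφd : MDifferentiableAt (𝓡 n) 𝓘(ℝ, EuclideanSpace ℝ (Fin n)) φ x :=
    mdifferentiableAt_extChartAt (mem_chart_source _ x)
  have key : (mfderiv (𝓡 n) 𝓘(ℝ, EuclideanSpace ℝ (Fin n)) φ x u : EuclideanSpace ℝ (Fin n)) =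
      mfderiv (𝓡 n) 𝓘(ℝ, EuclideanSpace ℝ (Fin n)) φ x v := by
    refine PiLp.ext fun i => ?_
    let l : EuclideanSpace ℝ (Fin n) →L[ℝ] ℝ := EuclideanSpace.proj i
    have hl : ∀ w : TangentSpace (𝓡 n) x, dirDeriv (𝓡 n) (fun y => χ y • l (φ y)) x w =
        l (mfderiv (𝓡 n) 𝓘(ℝ, EuclideanSpace ℝ (Fin n)) φ x w) := by
      intro w
      have e : (fun y => χ y • l (φ y)) =ᶠ[𝓝 x] l ∘ φ := by
        filter_upwards [χ.eventuallyEq_one] with y hy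
        simp [hy]
      rw [dirDeriv, e.mfderiv_eq, mfderiv_comp x l.mdifferentiableAt hφd,
        ContinuousLinearMap.mfderiv_eq]
      rfl
    have hs : ContMDiff (𝓡 n) 𝓘(ℝ, ℝ) ∞ (fun y => χ y • l (φ y)) := by
      refine χ.contMDiff_smul ?_
      exact l.contMDiff.comp_contMDiffOn contMDiffOn_extChartAt
    have := h _ hs
    rw [hl, hl] at this
    exact this
  have hi := isInvertible_mfderiv_extChartAt (I := 𝓡 n) (x := x) (mem_extChartAt_source x)
  obtain ⟨e, he⟩ := hi
  rw [← hφ] at he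
  rw [← he] at key
  exact e.injective key

/-! ### Lie algebroids -/

section Algebroid

variable {n : ℕ} {M : Type*} [TopologicalSpace M] [ChartedSpace (EuclideanSpace ℝ (Fin n)) M]
  {F : Type*} [NormedAddCommGroup F] [NormedSpace ℝ F]
  {E : M → Type*} [TopologicalSpace (TotalSpace F E)] [∀ x, TopologicalSpace (E x)]
  [FiberBundle F E] [∀ x, AddCommGroup (E x)] [∀ x, Module ℝ (E x)] [VectorBundle ℝ F E]
  [T2Space M] [IsManifold (𝓡 n) ∞ M] [FiniteDimensional ℝ F] [ContMDiffVectorBundle ∞ F E (𝓡 n)]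

variable (n F E) in
/-- A Lie algebroid structure on the smooth vector bundle `E → M`: a smooth anchor `ρ : E → TM` over
the identity and a Lie bracket on the smooth sections such that `[σ, fη] = f[σ, η] + (ρ(σ)f) η`. -/
structure LieAlgebroid where
  anchor : ∀ x : M, E x →ₗ[ℝ] TangentSpace (𝓡 n) x
  anchor_smooth : ContMDiff ((𝓡 n).prod 𝓘(ℝ, F)) (𝓡 n).tangent ∞
    (fun a : TotalSpace F E => (⟨a.proj, anchor a.proj a.snd⟩ : TangentBundle (𝓡 n) M))
  bracket : Cₛ^∞⟮𝓡 n; F, E⟯ →ₗ[ℝ] Cₛ^∞⟮𝓡 n; F, E⟯ →ₗ[ℝ] Cₛ^∞⟮𝓡 n; F, E⟯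
  bracket_self : ∀ σ, bracket σ σ = 0
  jacobi : ∀ σ η ζ, bracket σ (bracket η ζ) = bracket (bracket σ η) ζ + bracket η (bracket σ ζ)
  leibniz : ∀ (σ η : Cₛ^∞⟮𝓡 n; F, E⟯) (f : M → ℝ) (hf : ContMDiff (𝓡 n) 𝓘(ℝ, ℝ) ∞ f) (x : M),
    bracket σ ⟨f • ⇑η, hf.smul_section η.contMDiff⟩ x =
      f x • bracket σ η x + dirDeriv (𝓡 n) f x (anchor x (σ x)) • η x

namespace LieAlgebroid

variable (A : LieAlgebroid n F E)

theorem anchor_section_smooth (σ : Cₛ^∞⟮𝓡 n; F, E⟯) :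
    ContMDiff (𝓡 n) (𝓡 n).tangent ∞
      (fun x => (⟨x, A.anchor x (σ x)⟩ : TangentBundle (𝓡 n) M)) :=
  A.anchor_smooth.comp σ.contMDiff

end LieAlgebroid

/-- Every vector of a smooth vector bundle is the value of a smooth section. -/
theorem exists_section_through {x : M} (v : E x) :
    ∃ σ : Cₛ^∞⟮𝓡 n; F, E⟯, σ x = v := by
  obtain ⟨s, hs, hσ⟩ := FiberBundle.exists_contMDiffOn_extend (𝓡 n) F (k := ∞) v
  obtain ⟨χ, -, hχ⟩ := (SmoothBumpFunction.nhds_basis_tsupport (I := 𝓡 n) x).mem_iff.1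
    (interior_mem_nhds.2 hs)
  refine ⟨⟨fun y => χ y • FiberBundle.extend F v y, ?_⟩, ?_⟩
  · intro y
    by_cases hy : y ∈ tsupport χ
    · have h1 := (hσ y (interior_subset (hχ hy))).contMDiffAt (mem_interior_iff_mem_nhds.1 (hχ hy))
      exact (χ.contMDiff y).smul_section h1
    · have h0 : ContMDiffAt (𝓡 n) ((𝓡 n).prod 𝓘(ℝ, F)) ∞
          (fun y => (⟨y, 0⟩ : TotalSpace F E)) y :=
        contMDiff_zeroSection ℝ E y
      refine h0.congr_of_eventuallyEq ?_
      filter_upwards [(isClosed_tsupport χ).isOpen_compl.mem_nhds hy] with z hz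
      have : χ z = 0 := image_eq_zero_of_notMem_tsupport hz
      simp [this]
  · change χ x • FiberBundle.extend F v x = v
    simp

namespace LieAlgebroid

variable (A : LieAlgebroid n F E)

/-- The anchor is a homomorphism of Lie algebras from sections to vector fields. -/
theorem anchor_bracket (σ η : Cₛ^∞⟮𝓡 n; F, E⟯) (x : M) :
    A.anchor x (A.bracket σ η x) =
      mlieBracket (𝓡 n) (fun y => A.anchor y (σ y)) (fun y => A.anchor y (η y)) x := by
  rcases subsingleton_or_nontrivial F with hF | hF
  · have hE : ∀ y (v : E y), v = 0 := fun y v =>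
      (VectorBundle.continuousLinearEquivAt ℝ F E y).injective (Subsingleton.elim _ _)
    have h0 : (fun y => A.anchor y (σ y)) = 0 := by
      funext y; rw [hE y (σ y), map_zero]; rfl
    rw [h0, mlieBracket_zero_left, hE x (A.bracket σ η x), map_zero]
    rfl
  obtain ⟨c, hc⟩ := exists_ne (0 : F)
  have hv : ((VectorBundle.continuousLinearEquivAt ℝ F E x).symm c : E x) ≠ 0 := by
    exact (map_ne_zero_iff _ (VectorBundle.continuousLinearEquivAt ℝ F E x).symm.injective).2 hc
  obtain ⟨ζ, hζ⟩ := exists_section_through (n := n) (F := F)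
    ((VectorBundle.continuousLinearEquivAt ℝ F E x).symm c : E x)
  have hsm : ∀ (ξ : Cₛ^∞⟮𝓡 n; F, E⟯) (f : M → ℝ), ContMDiff (𝓡 n) 𝓘(ℝ, ℝ) ∞ f →
      ContMDiff (𝓡 n) 𝓘(ℝ, ℝ) ∞ (fun y => dirDeriv (𝓡 n) f y (A.anchor y (ξ y))) :=
    fun ξ f hf => dirDeriv_smooth hf (A.anchor_section_smooth ξ)
  have hL : ∀ (ξ τ : Cₛ^∞⟮𝓡 n; F, E⟯) (f : M → ℝ) (hf : ContMDiff (𝓡 n) 𝓘(ℝ, ℝ) ∞ f),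
      A.bracket ξ ⟨f • ⇑τ, hf.smul_section τ.contMDiff⟩ =
        ⟨f • ⇑(A.bracket ξ τ), hf.smul_section (A.bracket ξ τ).contMDiff⟩ +
        ⟨(fun y => dirDeriv (𝓡 n) f y (A.anchor y (ξ y))) • ⇑τ,
          (hsm ξ f hf).smul_section τ.contMDiff⟩ := by
    intro ξ τ f hf
    ext y
    exact A.leibniz ξ τ f hf y
  refine tangent_ext fun f hf => ?_
  rw [dirDeriv_mlieBracket (hf x) (A.anchor_section_smooth σ) (A.anchor_section_smooth η)]
  have hJ := congrArg (fun s : Cₛ^∞⟮𝓡 n; F, E⟯ => s x)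
    (A.jacobi σ η ⟨f • ⇑ζ, hf.smul_section ζ.contMDiff⟩)
  have hJ0 := congrArg (fun s : Cₛ^∞⟮𝓡 n; F, E⟯ => s x) (A.jacobi σ η ζ)
  simp only [hL _ _ f hf, map_add, hL _ _ _ (hsm η f hf), hL _ _ _ (hsm σ f hf),
    ContMDiffSection.coe_add, Pi.add_apply] at hJ hJ0
  have hmk : ∀ (g : M → ℝ) (τ : Cₛ^∞⟮𝓡 n; F, E⟯) (h) (y : M),
      (⟨g • ⇑τ, h⟩ : Cₛ^∞⟮𝓡 n; F, E⟯) y = g y • τ y := fun _ _ _ _ => rfl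
  simp only [hmk, hJ0, hζ, smul_add] at hJ
  refine smul_left_injective ℝ hv ?_
  beta_reduce
  linear_combination (norm := module) -hJ

end LieAlgebroid

namespace LieAlgebroid

variable (A : LieAlgebroid n F E)

/-- The fibre at `a ∈ E` of the prolongation `𝒯ᴱE`: the pairs `(b, v) ∈ E_{τ(a)} × T_aE` with
`ρ(b) = T_aτ(v)`. -/
def Prolongation (a : TotalSpace F E) :
    Submodule ℝ (E a.proj × TangentSpace ((𝓡 n).prod 𝓘(ℝ, F)) a) where
  carrier := {z | A.anchor a.proj z.1 =
    mfderiv ((𝓡 n).prod 𝓘(ℝ, F)) (𝓡 n) (TotalSpace.proj : TotalSpace F E → M) a z.2}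
  add_mem' := by
    intro z w hz hw
    simp only [mem_ofPred_eq, Prod.fst_add, Prod.snd_add, map_add] at *
    rw [hz, hw]
  zero_mem' := by simp
  smul_mem' := by
    intro c z hz
    simp only [mem_ofPred_eq, Prod.smul_fst, Prod.smul_snd, map_smul] at *
    rw [hz]

/-- A projectable section `a ↦ (σ(τ(a)), X(a))` of `𝒯ᴱE`. -/
structure ProjectableSection where
  base : Cₛ^∞⟮𝓡 n; F, E⟯
  field : Π a : TotalSpace F E, TangentSpace ((𝓡 n).prod 𝓘(ℝ, F)) a
  field_smooth : ContMDiff ((𝓡 n).prod 𝓘(ℝ, F)) ((𝓡 n).prod 𝓘(ℝ, F)).tangent ∞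
    (fun a => (⟨a, field a⟩ : TangentBundle ((𝓡 n).prod 𝓘(ℝ, F)) (TotalSpace F E)))
  mem : ∀ a, (base a.proj, field a) ∈ A.Prolongation a

namespace ProjectableSection

variable {A}

/-- The value of a projectable section at a point. -/
def eval (Z : A.ProjectableSection) (a : TotalSpace F E) : A.Prolongation a :=
  ⟨(Z.base a.proj, Z.field a), Z.mem a⟩

theorem bracket_mem (Z W : A.ProjectableSection) (a : TotalSpace F E) :
    (A.bracket Z.base W.base a.proj, mlieBracket ((𝓡 n).prod 𝓘(ℝ, F)) Z.field W.field a) ∈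
      A.Prolongation a := by
  have hτ : ContMDiff ((𝓡 n).prod 𝓘(ℝ, F)) (𝓡 n) ∞ (TotalSpace.proj : TotalSpace F E → M) :=
    contMDiff_proj E
  have hd : ∀ (f : M → ℝ), ContMDiff (𝓡 n) 𝓘(ℝ, ℝ) ∞ f → ∀ (b : TotalSpace F E)
      (v : TangentSpace ((𝓡 n).prod 𝓘(ℝ, F)) b),
      dirDeriv ((𝓡 n).prod 𝓘(ℝ, F)) (f ∘ TotalSpace.proj) b v =
        dirDeriv (𝓡 n) f b.proj (mfderiv ((𝓡 n).prod 𝓘(ℝ, F)) (𝓡 n) TotalSpace.proj b v) := by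
    intro f hf b v
    rw [dirDeriv, mfderiv_comp b (hf.mdifferentiableAt (by simp)) (hτ.mdifferentiableAt (by simp))]
    rfl
  have hrel : ∀ (Y : A.ProjectableSection) (f : M → ℝ), ContMDiff (𝓡 n) 𝓘(ℝ, ℝ) ∞ f →
      (fun b => dirDeriv ((𝓡 n).prod 𝓘(ℝ, F)) (f ∘ TotalSpace.proj) b (Y.field b)) =
      (fun x => dirDeriv (𝓡 n) f x (A.anchor x (Y.base x))) ∘ TotalSpace.proj := by
    intro Y f hf
    funext b
    rw [hd f hf b, ← (Y.mem b : A.anchor b.proj (Y.base b.proj) = _)]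
    rfl
  have hsm : ∀ (Y : A.ProjectableSection) (f : M → ℝ), ContMDiff (𝓡 n) 𝓘(ℝ, ℝ) ∞ f →
      ContMDiff (𝓡 n) 𝓘(ℝ, ℝ) ∞ (fun x => dirDeriv (𝓡 n) f x (A.anchor x (Y.base x))) :=
    fun Y f hf => dirDeriv_smooth hf (A.anchor_section_smooth Y.base)
  change A.anchor a.proj (A.bracket Z.base W.base a.proj) = mfderiv ((𝓡 n).prod 𝓘(ℝ, F)) (𝓡 n)
    TotalSpace.proj a (mlieBracket ((𝓡 n).prod 𝓘(ℝ, F)) Z.field W.field a)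
  rw [A.anchor_bracket]
  refine tangent_ext fun f hf => ?_
  rw [← hd f hf a, dirDeriv_mlieBracket (hf a.proj) (A.anchor_section_smooth Z.base)
    (A.anchor_section_smooth W.base), dirDeriv_mlieBracket ((hf.comp hτ) a)
    Z.field_smooth W.field_smooth, hrel W f hf, hrel Z f hf, hd _ (hsm W f hf), hd _ (hsm Z f hf),
    ← (Z.mem a : A.anchor a.proj (Z.base a.proj) = _),
    ← (W.mem a : A.anchor a.proj (W.base a.proj) = _)]

/-- The Lie bracket of projectable sections,
`[(σ₁, X₁), (σ₂, X₂)] = ([σ₁, σ₂], [X₁, X₂])`. -/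
def bracket (Z W : A.ProjectableSection) : A.ProjectableSection where
  base := A.bracket Z.base W.base
  field := mlieBracket ((𝓡 n).prod 𝓘(ℝ, F)) Z.field W.field
  field_smooth := by
    have h1 : IsManifold ((𝓡 n).prod 𝓘(ℝ, F)) ((∞ : ℕ∞ω) + 1) (TotalSpace F E) :=
      inferInstanceAs (IsManifold ((𝓡 n).prod 𝓘(ℝ, F)) ∞ (TotalSpace F E))
    have h2 : IsManifold ((𝓡 n).prod 𝓘(ℝ, F)) (minSmoothness ℝ 2) (TotalSpace F E) := by
      rw [minSmoothness_of_isRCLikeNormedField]; infer_instance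
    exact ContDiff.mlieBracket_vectorField (m := ⊤) (n := ⊤) Z.field_smooth W.field_smooth
      (by rw [minSmoothness_of_isRCLikeNormedField]; exact le_rfl)
  mem := bracket_mem Z W

end ProjectableSection
end LieAlgebroid

/-! ### The exterior differential -/

variable (E) in
/-- Fields of alternating `p`-linear forms on the fibres of `E`. -/
def PForm (p : ℕ) : Type _ := ∀ x : M, E x [⋀^Fin p]→ₗ[ℝ] ℝ

variable (n F) in
/-- A field of forms is smooth, i.e. a section of `⋀ᵖE*`, when its values on smooth sections are
smooth functions. -/
def PForm.IsSmooth {p : ℕ} (θ : PForm E p) : Prop :=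
  ∀ σ : Fin p → Cₛ^∞⟮𝓡 n; F, E⟯, ContMDiff (𝓡 n) 𝓘(ℝ, ℝ) ∞ (fun x => θ x (fun i => σ i x))

namespace LieAlgebroid

variable (A : LieAlgebroid n F E)

/-- The value `dθ(σ₀, …, σₚ)` of the exterior differential of the `p`-form `θ` on sections.  In the
second sum the pairs `i < j` are removed by deleting first the index `j` and then the index `i`. -/
def extDeriv : {p : ℕ} → PForm E p → (Fin (p + 1) → Cₛ^∞⟮𝓡 n; F, E⟯) → M → ℝ
  | 0, θ, σ, x => dirDeriv (𝓡 n) (fun y => θ y ![]) x (A.anchor x (σ 0 x))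
  | p + 1, θ, σ, x =>
      (∑ i : Fin (p + 2), (-1 : ℝ) ^ (i : ℕ) *
        dirDeriv (𝓡 n) (fun y => θ y (fun k => i.removeNth σ k y)) x (A.anchor x (σ i x))) +
      ∑ j : Fin (p + 2), ∑ i : Fin (p + 1),
        if i.castSucc < j then
          (-1 : ℝ) ^ ((i : ℕ) + (j : ℕ)) *
            θ x (Matrix.vecCons (A.bracket (σ i.castSucc) (σ j) x)
              (fun k => i.removeNth (j.removeNth σ) k x))
        else 0

/-! ### Geometry of the prolongation -/

/-- The vertical lift `b_aⱽ ∈ T_aE`: the vector tangent to the curve `t ↦ a + t b` at `t = 0`. -/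
def vertical (a : TotalSpace F E) (b : E a.proj) : TangentSpace ((𝓡 n).prod 𝓘(ℝ, F)) a :=
  mfderiv 𝓘(ℝ, ℝ) ((𝓡 n).prod 𝓘(ℝ, F))
    (fun t : ℝ => (⟨a.proj, a.snd + t • b⟩ : TotalSpace F E)) 0 (1 : ℝ)

theorem mfderiv_proj_vertical (a : TotalSpace F E) (b : E a.proj) :
    mfderiv ((𝓡 n).prod 𝓘(ℝ, F)) (𝓡 n) (TotalSpace.proj : TotalSpace F E → M) a
      (vertical (n := n) a b) = 0 := by
  have key : ∀ (c : ℝ → TotalSpace F E) (e : TotalSpace F E), c 0 = e →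
      (∀ t, (c t).proj = e.proj) →
      mfderiv ((𝓡 n).prod 𝓘(ℝ, F)) (𝓡 n) (TotalSpace.proj : TotalSpace F E → M) e
        (mfderiv 𝓘(ℝ, ℝ) ((𝓡 n).prod 𝓘(ℝ, F)) c 0 (1 : ℝ)) = 0 := by
    rintro c e rfl hc
    by_cases hd : MDifferentiableAt 𝓘(ℝ, ℝ) ((𝓡 n).prod 𝓘(ℝ, F)) c 0
    · have h1 := mfderiv_comp (I := 𝓘(ℝ, ℝ)) (I' := (𝓡 n).prod 𝓘(ℝ, F)) (I'' := 𝓡 n) (0 : ℝ)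
        (g := (TotalSpace.proj : TotalSpace F E → M))
        ((contMDiff_proj E (n := ∞) (IB := 𝓡 n) (F := F)).mdifferentiableAt (by simp)) hd
      have h2 : (TotalSpace.proj : TotalSpace F E → M) ∘ c = fun _ => (c 0).proj := funext hc
      have h3 : mfderiv 𝓘(ℝ, ℝ) (𝓡 n) ((TotalSpace.proj : TotalSpace F E → M) ∘ c) 0 = 0 := by
        rw [h2]; exact mfderiv_const
      rw [h3] at h1
      exact (congrArg (fun T => T (1 : ℝ)) h1).symm
    · rw [mfderiv_zero_of_not_mdifferentiableAt hd]
      exact map_zero _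
  exact key (fun t : ℝ => (⟨a.proj, a.snd + t • b⟩ : TotalSpace F E)) a (by simp) (fun _ => rfl)

/-- The vertical lift `ξⱽ(a, b) = (0, b_aⱽ)` with values in `𝒯ᴱE`. -/
def verticalLift (a : TotalSpace F E) (b : E a.proj) : A.Prolongation a :=
  ⟨(0, vertical a b), by
    change A.anchor a.proj 0 = _
    rw [map_zero]
    exact (mfderiv_proj_vertical a b).symm⟩

/-- The vertical endomorphism `S(b, v) = ξⱽ(a, b)`. -/
def verticalEndomorphism {a : TotalSpace F E} (z : A.Prolongation a) : A.Prolongation a :=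
  A.verticalLift a z.1.1

/-- The Liouville section `Δ(a) = ξⱽ(a, a)`. -/
def liouville (a : TotalSpace F E) : A.Prolongation a := A.verticalLift a a.snd

/-- The differential `df` of a function on `E`, evaluated on an element of `𝒯ᴱE`:
`df(z) = ρ¹(z) f`, where `ρ¹(b, v) = v`. -/
def diff (f : TotalSpace F E → ℝ) {a : TotalSpace F E} (z : A.Prolongation a) : ℝ :=
  dirDeriv ((𝓡 n).prod 𝓘(ℝ, F)) f a z.1.2

/-- The value `dθ(Z, W)(a) = ρ¹(Z)(θ(W)) - ρ¹(W)(θ(Z)) - θ([Z, W])` of the differential of a 1-form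
`θ` on `𝒯ᴱE` on projectable sections. -/
def extDerivProjectable (θ : Π a : TotalSpace F E, A.Prolongation a → ℝ)
    (Z W : A.ProjectableSection) (a : TotalSpace F E) : ℝ :=
  dirDeriv ((𝓡 n).prod 𝓘(ℝ, F)) (fun b => θ b (W.eval b)) a (Z.field a) -
    dirDeriv ((𝓡 n).prod 𝓘(ℝ, F)) (fun b => θ b (Z.eval b)) a (W.field a) -
    θ a ((Z.bracket W).eval a)

/-- The differential `dθ` at `a` of a 1-form `θ` on `𝒯ᴱE`: the bilinear form on the fibre whose
value on the values at `a` of projectable sections is given by the formula above.  (Every element of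
the fibre is the value of a projectable section and, for a smooth 1-form, the formula is tensorial,
so there is exactly one such bilinear form.) -/
def extDerivOne (θ : Π a : TotalSpace F E, A.Prolongation a → ℝ) (a : TotalSpace F E) :
    LinearMap.BilinForm ℝ (A.Prolongation a) :=
  Classical.epsilon fun B : LinearMap.BilinForm ℝ (A.Prolongation a) =>
    ∀ Z W : A.ProjectableSection, B (Z.eval a) (W.eval a) = A.extDerivProjectable θ Z W a

/-! ### Lagrangian mechanics -/

/-- The Cartan 1-form `θ_L = S*(dL)`. -/
def cartanOneForm (L : TotalSpace F E → ℝ) (a : TotalSpace F E) (z : A.Prolongation a) : ℝ :=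
  A.diff L (A.verticalEndomorphism z)

/-- The Cartan 2-form `ω_L = -dθ_L`. -/
def cartanTwoForm (L : TotalSpace F E → ℝ) (a : TotalSpace F E) :
    LinearMap.BilinForm ℝ (A.Prolongation a) :=
  -A.extDerivOne (A.cartanOneForm L) a

/-- The energy `E_L = d_Δ L - L`. -/
def energy (L : TotalSpace F E → ℝ) (a : TotalSpace F E) : ℝ := A.diff L (A.liouville a) - L a

end LieAlgebroid

/-! ### Constraints -/

variable (n F E) in
/-- A smooth vector subbundle of `E` over `M`: a family of subspaces of the fibres which is locally
spanned by smooth linearly independent sections. -/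
structure Subbundle where
  fiber : ∀ x : M, Submodule ℝ (E x)
  exists_frame : ∀ x : M, ∃ (k : ℕ) (s : Fin k → Cₛ^∞⟮𝓡 n; F, E⟯), ∀ᶠ y in 𝓝 x,
    LinearIndependent ℝ (fun i => s i y) ∧ Submodule.span ℝ (range fun i => s i y) = fiber y

namespace Subbundle

variable (D : Subbundle n F E)

/-- The total space of `D`, as a subset of `E`. -/
def carrier : Set (TotalSpace F E) := {a | a.snd ∈ D.fiber a.proj}

/-- The tangent space `T_aD ⊆ T_aE` at `a ∈ D` of the embedded closed submanifold `D` of `E`: the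
tangent vectors which annihilate all smooth functions vanishing on `D`. -/
def tangent (a : TotalSpace F E) : Submodule ℝ (TangentSpace ((𝓡 n).prod 𝓘(ℝ, F)) a) where
  carrier := {v | ∀ f : TotalSpace F E → ℝ, ContMDiff ((𝓡 n).prod 𝓘(ℝ, F)) 𝓘(ℝ, ℝ) ∞ f →
    (∀ d ∈ D.carrier, f d = 0) → dirDeriv ((𝓡 n).prod 𝓘(ℝ, F)) f a v = 0}
  add_mem' := by
    intro v w hv hw f hf h0
    have h := map_add (mfderiv ((𝓡 n).prod 𝓘(ℝ, F)) 𝓘(ℝ, ℝ) f a) v w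
    have h1 : mfderiv ((𝓡 n).prod 𝓘(ℝ, F)) 𝓘(ℝ, ℝ) f a v = 0 := hv f hf h0
    have h2 : mfderiv ((𝓡 n).prod 𝓘(ℝ, F)) 𝓘(ℝ, ℝ) f a w = 0 := hw f hf h0
    rw [h1, h2, add_zero] at h
    exact h
  zero_mem' := fun f _ _ => map_zero (mfderiv ((𝓡 n).prod 𝓘(ℝ, F)) 𝓘(ℝ, ℝ) f a)
  smul_mem' := by
    intro c v hv f hf h0
    have h := map_smul (mfderiv ((𝓡 n).prod 𝓘(ℝ, F)) 𝓘(ℝ, ℝ) f a) c v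
    have h1 : mfderiv ((𝓡 n).prod 𝓘(ℝ, F)) 𝓘(ℝ, ℝ) f a v = 0 := hv f hf h0
    rw [h1, smul_zero] at h
    exact h

/-- Smooth functions on the submanifold `D` of `E`: the functions which are locally restrictions of
smooth functions on `E`. -/
structure SmoothFunction where
  toFun : D.carrier → ℝ
  exists_extension : ∀ a : D.carrier, ∃ f : TotalSpace F E → ℝ,
    ContMDiff ((𝓡 n).prod 𝓘(ℝ, F)) 𝓘(ℝ, ℝ) ∞ f ∧ ∀ᶠ b in 𝓝 a, toFun b = f b

variable {D} in
/-- A smooth function on `E` which extends `f` near `a`. -/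
def SmoothFunction.extension (f : D.SmoothFunction) (a : D.carrier) : TotalSpace F E → ℝ :=
  (f.exists_extension a).choose

end Subbundle

namespace LieAlgebroid

variable (A : LieAlgebroid n F E)

/-- The fibre at `a ∈ D` of `𝒯ᴰD`, as a subspace of the fibre of `𝒯ᴱE`:
the pairs `(b, v)` with `b ∈ D` and `v ∈ T_aD`. -/
def prolongationConstraint (D : Subbundle n F E) (a : TotalSpace F E) :
    Submodule ℝ (A.Prolongation a) :=
  ((D.fiber a.proj).prod (D.tangent a)).comap (A.Prolongation a).subtype

/-- `z` is a value at `a ∈ D` of a solution of the Lagrange-d'Alembert equations: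
`z ∈ 𝒯ᴰD`, `S z = Δ(a)` and `i_z ω_L - dE_L = λ ∘ 𝒯τ` for some `λ ∈ D°`. -/
def IsLagrangeDAlembert (L : TotalSpace F E → ℝ) (D : Subbundle n F E) (a : TotalSpace F E)
    (z : A.Prolongation a) : Prop :=
  z ∈ A.prolongationConstraint D a ∧
    A.verticalEndomorphism z = A.liouville a ∧
    ∃ μ ∈ (D.fiber a.proj).dualAnnihilator, ∀ u : A.Prolongation a,
      A.cartanTwoForm L a z u - A.diff (A.energy L) u = μ u.1.1

/-- `(L, D)` is a regular constrained Lagrangian system: the Lagrangian is regular along `D` (hence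
near `D`, nondegeneracy of `ω_L` being an open condition), and at every point of `D` the
Lagrange-d'Alembert equations have a unique solution. -/
structure IsRegular (L : TotalSpace F E → ℝ) (D : Subbundle n F E) : Prop where
  nondegenerate : ∀ a ∈ D.carrier, (A.cartanTwoForm L a).Nondegenerate
  existsUnique : ∀ a ∈ D.carrier, ∃! z, A.IsLagrangeDAlembert L D a z

/-- The value at `a` of the Hamiltonian section `X_f` of a function `f` on `E`:
`i_{X_f} ω_L = df`. -/
def hamiltonian (L f : TotalSpace F E → ℝ) (a : TotalSpace F E) : A.Prolongation a :=
  Classical.epsilon fun x => ∀ w, A.cartanTwoForm L a x w = A.diff f w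

/-- The projector `P̄` of the fibre of `𝒯ᴱE` at `a ∈ D` onto the fibre of `𝒯ᴰD` along its orthogonal
with respect to `ω_L`. (For a regular system the two are complementary.) -/
def projector (L : TotalSpace F E → ℝ) (D : Subbundle n F E) (a : TotalSpace F E) :
    A.Prolongation a →ₗ[ℝ] A.Prolongation a :=
  open Classical in
  if h : IsCompl (A.prolongationConstraint D a)
      ((A.cartanTwoForm L a).orthogonal (A.prolongationConstraint D a)) then
    Submodule.projection _ _ h
  else 0

/-- The nonholonomic bracket `{f, g}_nh = ω_L(P̄(X_f), P̄(X_g))` of smooth functions on `D`. -/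
def nonholonomicBracket (L : TotalSpace F E → ℝ) (D : Subbundle n F E) (f g : D.SmoothFunction)
    (a : D.carrier) : ℝ :=
  A.cartanTwoForm L a (A.projector L D a (A.hamiltonian L (f.extension a) a))
    (A.projector L D a (A.hamiltonian L (g.extension a) a))

end LieAlgebroid

end Algebroid

/-! ### Morphisms -/

section Morphism

variable {n n' : ℕ} {M M' : Type*}
  [TopologicalSpace M] [ChartedSpace (EuclideanSpace ℝ (Fin n)) M]
  [TopologicalSpace M'] [ChartedSpace (EuclideanSpace ℝ (Fin n')) M']
  {F F' : Type*} [NormedAddCommGroup F] [NormedSpace ℝ F]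
  [NormedAddCommGroup F'] [NormedSpace ℝ F']
  {E : M → Type*} [TopologicalSpace (TotalSpace F E)] [∀ x, TopologicalSpace (E x)]
  [FiberBundle F E] [∀ x, AddCommGroup (E x)] [∀ x, Module ℝ (E x)] [VectorBundle ℝ F E]
  {E' : M' → Type*} [TopologicalSpace (TotalSpace F' E')] [∀ x, TopologicalSpace (E' x)]
  [FiberBundle F' E'] [∀ x, AddCommGroup (E' x)] [∀ x, Module ℝ (E' x)] [VectorBundle ℝ F' E']
  [T2Space M] [IsManifold (𝓡 n) ∞ M] [FiniteDimensional ℝ F] [ContMDiffVectorBundle ∞ F E (𝓡 n)]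
  [T2Space M'] [IsManifold (𝓡 n') ∞ M'] [FiniteDimensional ℝ F']
  [ContMDiffVectorBundle ∞ F' E' (𝓡 n')]

/-- A morphism of Lie algebroids: a smooth vector bundle map `Φ : E → E'` over `φ : M → M'` such that
`Φ*(dθ) = d(Φ*θ)` for all forms `θ` on `E'`.  The value of `Φ*(dθ)` at `m` on `σ₀(m), …, σₚ(m)` is
computed with arbitrary sections of `E'` that take the values `Φ(σᵢ(m))` at `φ(m)`. -/
structure LieAlgebroidMorphism (A : LieAlgebroid n F E) (A' : LieAlgebroid n' F' E') where
  base : M → M'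
  base_smooth : ContMDiff (𝓡 n) (𝓡 n') ∞ base
  fiberMap : ∀ x, E x →ₗ[ℝ] E' (base x)
  smooth : ContMDiff ((𝓡 n).prod 𝓘(ℝ, F)) ((𝓡 n').prod 𝓘(ℝ, F')) ∞
    (fun a : TotalSpace F E => (⟨base a.proj, fiberMap a.proj a.snd⟩ : TotalSpace F' E'))
  pullback_extDeriv : ∀ (p : ℕ) (θ : PForm E' p), θ.IsSmooth n' F' →
    ∀ (m : M) (σ : Fin (p + 1) → Cₛ^∞⟮𝓡 n; F, E⟯) (σ' : Fin (p + 1) → Cₛ^∞⟮𝓡 n'; F', E'⟯),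
      (∀ i, σ' i (base m) = fiberMap m (σ i m)) →
      A'.extDeriv θ σ' (base m) =
        A.extDeriv (fun x => (θ (base x)).compLinearMap (fiberMap x)) σ m

namespace LieAlgebroidMorphism

variable {A : LieAlgebroid n F E} {A' : LieAlgebroid n' F' E'} (Φ : LieAlgebroidMorphism A A')

/-- The map `Φ : E → E'` of total spaces. -/
def toFun (a : TotalSpace F E) : TotalSpace F' E' := ⟨Φ.base a.proj, Φ.fiberMap a.proj a.snd⟩

theorem mem_carrier {D : Subbundle n F E} {D' : Subbundle n' F' E'}
    (h : ∀ x, (D.fiber x).map (Φ.fiberMap x) = D'.fiber (Φ.base x)) :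
    ∀ a ∈ D.carrier, Φ.toFun a ∈ D'.carrier := by
  intro a ha
  change Φ.fiberMap a.proj a.snd ∈ D'.fiber (Φ.base a.proj)
  rw [← h]
  exact Submodule.mem_map_of_mem ha

/-- The map `D → D'` induced by `Φ` if `Φ(D) ⊆ D'`. -/
def restrict {D : Subbundle n F E} {D' : Subbundle n' F' E'}
    (h : ∀ a ∈ D.carrier, Φ.toFun a ∈ D'.carrier) (a : D.carrier) : D'.carrier :=
  ⟨Φ.toFun a, h a a.2⟩

/-- The pullback `f' ∘ Φ ∈ C^∞(D)` of `f' ∈ C^∞(D')`. -/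
def pullback {D : Subbundle n F E} {D' : Subbundle n' F' E'}
    (h : ∀ a ∈ D.carrier, Φ.toFun a ∈ D'.carrier) (f : D'.SmoothFunction) : D.SmoothFunction where
  toFun := f.toFun ∘ Φ.restrict h
  exists_extension := by
    intro a
    obtain ⟨g, hg, hfg⟩ := f.exists_extension (Φ.restrict h a)
    refine ⟨g ∘ Φ.toFun, hg.comp Φ.smooth, ?_⟩
    have hc : Continuous (Φ.restrict h) :=
      Continuous.subtype_mk (Φ.smooth.continuous.comp continuous_subtype_val) _
    exact hc.continuousAt.eventually hfg

end LieAlgebroidMorphism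

end Morphism

end

noncomputable section

/-! ### Calculus on the total space of a vector bundle -/

/-! The prolonged map `Φ.prolong a`, `(b, v) ↦ (Φ b, TΦ v)`, is onto because `Φ` is onto on fibres:
an error in the second component is vertical and is corrected by a vertical lift, so the base map
need not be a submersion (`prolong_surjective`). It respects vertical endomorphisms, Liouville
sections and energies, and it pulls `ω_L'` back to `ω_L` (`cartanTwoForm_comp`). Its kernel
therefore lies in the radical of `ω_L`, and at points of `D`, where `ω_L` is nondegenerate, it is an
isomorphism (`prolong_injective`).

This isomorphism matches `𝒯ᴰD` with its primed counterpart
(`prolong_mem_prolongationConstraint_iff`), hence also the solutions of the Lagrange-d'Alembert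
equations (`isLagrangeDAlembert_prolong_iff`), the orthogonals and the projectors
(`projector_prolong`). As `D → D'` is onto, `(L', D')` is regular. Two extensions of one function on
`D` have the same derivatives along `TD`, so their Hamiltonian sections differ by an element
orthogonal to `𝒯ᴰD`, which `P̄` kills (`projector_hamiltonian_pullback`). Equality of the brackets
follows.

The main work is the naturality of `ω_L`. The morphism condition concerns one-forms on the bundle
`E'` over `M'`, whereas `θ_L` also depends on the point of the total space. Freezing the
coefficients of the Legendre transform in a local frame gives a one-form `θ` over `M'` that agrees
with it at `Φ(a)`. The derivatives of the two pairings with a section differ by a term that sees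
only the value of the section at the point (`dirDeriv_legendre_along`). This term is the same for
both algebroids and cancels, which leaves the morphism condition for `θ` (`cartanFormula_comp`).
That condition allows arbitrary sections with prescribed values, so the same identity shows that the
formula for `dθ_L` does not depend on the sections. No separate proof of tensoriality is needed. -/

theorem dirDeriv_comp {H₁ H₂ V₁ V₂ N₁ N₂ : Type*} [TopologicalSpace H₁] [TopologicalSpace H₂]
    [NormedAddCommGroup V₁] [NormedSpace ℝ V₁] [NormedAddCommGroup V₂] [NormedSpace ℝ V₂]
    {I₁ : ModelWithCorners ℝ V₁ H₁} {I₂ : ModelWithCorners ℝ V₂ H₂}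
    [TopologicalSpace N₁] [ChartedSpace H₁ N₁] [TopologicalSpace N₂] [ChartedSpace H₂ N₂]
    {f : N₂ → ℝ} {c : N₁ → N₂} {x : N₁} (hf : MDifferentiableAt I₂ 𝓘(ℝ, ℝ) f (c x))
    (hc : MDifferentiableAt I₁ I₂ c x) (v : TangentSpace I₁ x) :
    dirDeriv I₁ (fun y => f (c y)) x v = dirDeriv I₂ f (c x) (mfderiv I₁ I₂ c x v) := by
  have h := mfderiv_comp x hf hc
  exact congrArg (fun T => T v) h

/-! ### Algebraic rules for directional derivatives. -/

section DirDerivAlgebra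

variable {H V N : Type*} [TopologicalSpace H] [NormedAddCommGroup V] [NormedSpace ℝ V]
  {I : ModelWithCorners ℝ V H} [TopologicalSpace N] [ChartedSpace H N] {x : N}

theorem dirDeriv_map_add (f : N → ℝ) (v w : TangentSpace I x) :
    dirDeriv I f x (v + w) = dirDeriv I f x v + dirDeriv I f x w :=
  map_add (mfderiv I 𝓘(ℝ, ℝ) f x) v w

theorem dirDeriv_map_smul (f : N → ℝ) (c : ℝ) (v : TangentSpace I x) :
    dirDeriv I f x (c • v) = c * dirDeriv I f x v :=
  map_smul (mfderiv I 𝓘(ℝ, ℝ) f x) c v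

theorem dirDeriv_add {f g : N → ℝ} (hf : MDifferentiableAt I 𝓘(ℝ, ℝ) f x)
    (hg : MDifferentiableAt I 𝓘(ℝ, ℝ) g x) (v : TangentSpace I x) :
    dirDeriv I (fun y => f y + g y) x v = dirDeriv I f x v + dirDeriv I g x v :=
  congrArg (fun T => T v) (mfderiv_add hf hg)

theorem dirDeriv_sub {f g : N → ℝ} (hf : MDifferentiableAt I 𝓘(ℝ, ℝ) f x)
    (hg : MDifferentiableAt I 𝓘(ℝ, ℝ) g x) (v : TangentSpace I x) :
    dirDeriv I (fun y => f y - g y) x v = dirDeriv I f x v - dirDeriv I g x v :=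
  congrArg (fun T => T v) (mfderiv_sub hf hg)

theorem dirDeriv_mul {f g : N → ℝ} (hf : MDifferentiableAt I 𝓘(ℝ, ℝ) f x)
    (hg : MDifferentiableAt I 𝓘(ℝ, ℝ) g x) (v : TangentSpace I x) :
    dirDeriv I (fun y => f y * g y) x v = f x * dirDeriv I g x v + dirDeriv I f x v * g x := by
  have h := congrArg (fun T => T v) (hf.hasMFDerivAt.mul hg.hasMFDerivAt).mfderiv
  refine h.trans ?_
  change f x * dirDeriv I g x v + g x * dirDeriv I f x v = _
  ring

theorem dirDeriv_const_mul {f : N → ℝ} (hf : MDifferentiableAt I 𝓘(ℝ, ℝ) f x) (c : ℝ)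
    (v : TangentSpace I x) : dirDeriv I (fun y => c * f y) x v = c * dirDeriv I f x v := by
  have h := dirDeriv_mul (f := fun _ : N => c) (x := x) (I := I) mdifferentiableAt_const hf v
  have h0 : dirDeriv I (fun _ : N => c) x v = 0 := by
    rw [dirDeriv, mfderiv_const]; rfl
  rw [h, h0, zero_mul, add_zero]

theorem mdifferentiableAt_sum {k : ℕ} {f : Fin k → N → ℝ}
    (hf : ∀ i, MDifferentiableAt I 𝓘(ℝ, ℝ) (f i) x) :
    MDifferentiableAt I 𝓘(ℝ, ℝ) (fun y => ∑ i, f i y) x := by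
  have h := MDifferentiableAt.sum (I := I) (t := Finset.univ) (f := f) (z := x) fun i _ => hf i
  convert h using 1
  ext y
  simp

theorem dirDeriv_sum {k : ℕ} {f : Fin k → N → ℝ}
    (hf : ∀ i, MDifferentiableAt I 𝓘(ℝ, ℝ) (f i) x) (v : TangentSpace I x) :
    dirDeriv I (fun y => ∑ i, f i y) x v = ∑ i, dirDeriv I (f i) x v := by
  induction k with
  | zero =>
    have : (fun y : N => ∑ i : Fin 0, f i y) = fun _ => (0 : ℝ) := by ext; simp
    rw [this, dirDeriv, mfderiv_const]
    simp only [Finset.univ_eq_empty, Finset.sum_empty]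
    rfl
  | succ k ih =>
    simp only [Fin.sum_univ_succ]
    rw [dirDeriv_add (hf 0) (mdifferentiableAt_sum fun i => hf i.succ), ih fun i => hf i.succ]

theorem dirDeriv_congr {f g : N → ℝ} (h : f =ᶠ[𝓝 x] g) (v : TangentSpace I x) :
    dirDeriv I f x v = dirDeriv I g x v := by
  rw [dirDeriv, h.mfderiv_eq]; rfl

end DirDerivAlgebra

set_option linter.unusedSectionVars false

section SingleBundle

variable {n : ℕ} {M : Type*} [TopologicalSpace M] [ChartedSpace (EuclideanSpace ℝ (Fin n)) M]
  {F : Type*} [NormedAddCommGroup F] [NormedSpace ℝ F]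
  {E : M → Type*} [TopologicalSpace (TotalSpace F E)] [∀ x, TopologicalSpace (E x)]
  [FiberBundle F E] [∀ x, AddCommGroup (E x)] [∀ x, Module ℝ (E x)] [VectorBundle ℝ F E]
  [T2Space M] [IsManifold (𝓡 n) ∞ M] [FiniteDimensional ℝ F] [ContMDiffVectorBundle ∞ F E (𝓡 n)]

-- Points of one fibre are separated in a trivialization, points of different fibres by the
-- projection to the Hausdorff base. This makes bump functions available on the total space.
variable (F E) in
theorem t2Space_totalSpace : T2Space (TotalSpace F E) := by
  refine ⟨fun a b hab => ?_⟩
  by_cases h : a.proj = b.proj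
  · set e := trivializationAt F E a.proj
    have ha : a ∈ e.source := e.mem_source.2 (mem_baseSet_trivializationAt F E a.proj)
    have hb : b ∈ e.source := e.mem_source.2 (h ▸ mem_baseSet_trivializationAt F E a.proj)
    have hne : e a ≠ e b := fun h => hab (e.injOn ha hb h)
    obtain ⟨u, v, hu, hv, hau, hbv, huv⟩ := t2_separation hne
    refine ⟨e.source ∩ e ⁻¹' u, e.source ∩ e ⁻¹' v,
      e.continuousOn_toFun.isOpen_inter_preimage e.open_source hu,
      e.continuousOn_toFun.isOpen_inter_preimage e.open_source hv, ⟨ha, hau⟩, ⟨hb, hbv⟩, ?_⟩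
    exact (huv.preimage e).mono inter_subset_right inter_subset_right
  · exact separated_by_continuous (FiberBundle.continuous_proj F E) h

section AlongMap

variable {H V N : Type*} [TopologicalSpace H] [NormedAddCommGroup V] [NormedSpace ℝ V]
  {I : ModelWithCorners ℝ V H} [TopologicalSpace N] [ChartedSpace H N]

/-- Fibrewise affine combinations of smooth maps into a vector bundle are smooth. -/
theorem contMDiff_add_smul {q : N → M} {s t : Π x, E (q x)} {c : N → ℝ}
    (hs : ContMDiff I ((𝓡 n).prod 𝓘(ℝ, F)) ∞ (fun x => (⟨q x, s x⟩ : TotalSpace F E)))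
    (ht : ContMDiff I ((𝓡 n).prod 𝓘(ℝ, F)) ∞ (fun x => (⟨q x, t x⟩ : TotalSpace F E)))
    (hc : ContMDiff I 𝓘(ℝ, ℝ) ∞ c) :
    ContMDiff I ((𝓡 n).prod 𝓘(ℝ, F)) ∞ (fun x => (⟨q x, s x + c x • t x⟩ : TotalSpace F E)) := by
  intro x
  have h1 := contMDiffAt_totalSpace.1 (hs x)
  have h2 := contMDiffAt_totalSpace.1 (ht x)
  refine contMDiffAt_totalSpace.2 ⟨h1.1, ?_⟩
  refine (h1.2.add ((hc x).smul h2.2)).congr_of_eventuallyEq ?_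
  have hq : ContinuousAt q x := h1.1.continuousAt
  filter_upwards [hq.preimage_mem_nhds ((trivializationAt F E (q x)).open_baseSet.mem_nhds
    (mem_baseSet_trivializationAt F E (q x)))] with y hy
  have hl := (trivializationAt F E (q x)).linear ℝ hy
  change ((trivializationAt F E (q x)) ⟨q y, s y + c y • t y⟩).2 = _
  rw [hl.map_add, hl.map_smul]
  rfl

end AlongMap

/-- The fibre coordinate in a trivialization is differentiable over its base set. -/
theorem contMDiffAt_trivialization_snd {m : M} {a : TotalSpace F E}
    (ha : a.proj ∈ (trivializationAt F E m).baseSet) :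
    ContMDiffAt ((𝓡 n).prod 𝓘(ℝ, F)) 𝓘(ℝ, F) ∞
      (fun b : TotalSpace F E => (trivializationAt F E m b).2) a :=
  (((trivializationAt F E m).contMDiffAt_iff (f := id) (IB := 𝓡 n) (n := ∞)
    ((trivializationAt F E m).mem_source.2 ha)).1 contMDiffAt_id).2

/-- Tangent vectors to the total space are determined by their components in the base and
in the fibre of a trivialization. -/
theorem totalSpace_tangent_ext {a : TotalSpace F E}
    {v w : TangentSpace ((𝓡 n).prod 𝓘(ℝ, F)) a}
    (h1 : mfderiv ((𝓡 n).prod 𝓘(ℝ, F)) (𝓡 n) (TotalSpace.proj : TotalSpace F E → M) a v =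
      mfderiv ((𝓡 n).prod 𝓘(ℝ, F)) (𝓡 n) (TotalSpace.proj : TotalSpace F E → M) a w)
    (h2 : mfderiv ((𝓡 n).prod 𝓘(ℝ, F)) 𝓘(ℝ, F)
        (fun b : TotalSpace F E => (trivializationAt F E a.proj b).2) a v =
      mfderiv ((𝓡 n).prod 𝓘(ℝ, F)) 𝓘(ℝ, F)
        (fun b : TotalSpace F E => (trivializationAt F E a.proj b).2) a w) : v = w := by
  set e := trivializationAt F E a.proj with he
  have ha : a ∈ e.source := e.mem_source.2 (mem_baseSet_trivializationAt F E a.proj)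
  -- The trivialization is a local diffeomorphism, so its derivative is injective; `key` identifies
  -- the components of this derivative with the two given ones.
  have hd : e.toOpenPartialHomeomorph.MDifferentiable ((𝓡 n).prod 𝓘(ℝ, F)) ((𝓡 n).prod 𝓘(ℝ, F)) :=
    ⟨(e.contMDiffOn (n := ∞)).mdifferentiableOn (by simp),
      (e.contMDiffOn_symm (n := ∞)).mdifferentiableOn (by simp)⟩
  refine hd.mfderiv_injective ha ?_
  have hp : MDifferentiableAt ((𝓡 n).prod 𝓘(ℝ, F)) (𝓡 n) (TotalSpace.proj : TotalSpace F E → M) a :=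
    (contMDiff_proj E (n := ∞) a).mdifferentiableAt (by simp)
  have hs := (contMDiffAt_trivialization_snd (n := n) (m := a.proj)
    (mem_baseSet_trivializationAt F E a.proj)).mdifferentiableAt (by simp)
  have hev : (e : TotalSpace F E → M × F) =ᶠ[𝓝 a] fun b => (b.proj, (e b).2) := by
    filter_upwards [e.open_source.mem_nhds ha] with b hb
    exact (e.mk_proj_snd hb).symm
  have hm := mfderiv_prodMk hp hs
  have key : ∀ u, mfderiv ((𝓡 n).prod 𝓘(ℝ, F)) ((𝓡 n).prod 𝓘(ℝ, F)) e a u =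
      (mfderiv ((𝓡 n).prod 𝓘(ℝ, F)) (𝓡 n) (TotalSpace.proj : TotalSpace F E → M) a u,
      mfderiv ((𝓡 n).prod 𝓘(ℝ, F)) 𝓘(ℝ, F) (fun b : TotalSpace F E => (e b).2) a u) := by
    intro u
    rw [hev.mfderiv_eq]
    exact congrArg (fun T => T u) hm
  change mfderiv ((𝓡 n).prod 𝓘(ℝ, F)) ((𝓡 n).prod 𝓘(ℝ, F)) e a v =
    mfderiv ((𝓡 n).prod 𝓘(ℝ, F)) ((𝓡 n).prod 𝓘(ℝ, F)) e a w
  rw [key, key]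
  exact Prod.ext h1 h2

/-! ### Vertical lifts and the Legendre transformation. -/

namespace LieAlgebroid

/-- The straight line `t ↦ a + t b` in a fibre is smooth. -/
theorem contMDiff_fibre_line (a : TotalSpace F E) (b : E a.proj) :
    ContMDiff 𝓘(ℝ, ℝ) ((𝓡 n).prod 𝓘(ℝ, F)) ∞
      (fun t : ℝ => (⟨a.proj, a.snd + t • b⟩ : TotalSpace F E)) :=
  contMDiff_add_smul (q := fun _ : ℝ => a.proj) (s := fun _ => a.snd) (t := fun _ => b)
    contMDiff_const contMDiff_const contMDiff_id

/-- Chain rule along the fibre line. The target is a general manifold so that it applies to fibre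
coordinates and to `Φ` as well as to functions. -/
theorem mfderiv_vertical {H' V' N' : Type*} [TopologicalSpace H'] [NormedAddCommGroup V']
    [NormedSpace ℝ V'] {I' : ModelWithCorners ℝ V' H'} [TopologicalSpace N'] [ChartedSpace H' N']
    {a : TotalSpace F E} (b : E a.proj) {f : TotalSpace F E → N'}
    (hf : MDifferentiableAt ((𝓡 n).prod 𝓘(ℝ, F)) I' f a) :
    mfderiv 𝓘(ℝ, ℝ) I' (fun t : ℝ => f ⟨a.proj, a.snd + t • b⟩) 0 (1 : ℝ) =
      mfderiv ((𝓡 n).prod 𝓘(ℝ, F)) I' f a (vertical a b) := by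
  have h0 : (⟨a.proj, a.snd + (0 : ℝ) • b⟩ : TotalSpace F E) = a := by simp
  have hl := (contMDiff_fibre_line (n := n) a b).mdifferentiableAt (x := 0) (by simp)
  have hf' : MDifferentiableAt ((𝓡 n).prod 𝓘(ℝ, F)) I' f
    ((fun t : ℝ => (⟨a.proj, a.snd + t • b⟩ : TotalSpace F E)) 0) := by
    simpa using hf
  have h := congrArg (fun T => T (1 : ℝ)) (mfderiv_comp (0 : ℝ) hf' hl)
  refine h.trans ?_
  change mfderiv ((𝓡 n).prod 𝓘(ℝ, F)) I' f ⟨a.proj, a.snd + (0 : ℝ) • b⟩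
    (mfderiv 𝓘(ℝ, ℝ) ((𝓡 n).prod 𝓘(ℝ, F))
      (fun t : ℝ => (⟨a.proj, a.snd + t • b⟩ : TotalSpace F E)) 0 (1 : ℝ)) = _
  unfold vertical
  -- The line passes through `a + 0 • b`, which is only propositionally `a`; the velocity is
  -- generalized so that the base point can be rewritten.
  generalize mfderiv 𝓘(ℝ, ℝ) ((𝓡 n).prod 𝓘(ℝ, F))
      (fun t : ℝ => (⟨a.proj, a.snd + t • b⟩ : TotalSpace F E)) 0 (1 : ℝ) = w
  revert w
  rw [h0]
  intro w
  rfl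

theorem dirDeriv_vertical {a : TotalSpace F E} (b : E a.proj) {f : TotalSpace F E → ℝ}
    (hf : MDifferentiableAt ((𝓡 n).prod 𝓘(ℝ, F)) 𝓘(ℝ, ℝ) f a) :
    dirDeriv ((𝓡 n).prod 𝓘(ℝ, F)) f a (vertical a b) =
      deriv (fun t : ℝ => f ⟨a.proj, a.snd + t • b⟩) 0 := by
  rw [dirDeriv, ← mfderiv_vertical b hf, mfderiv_eq_fderiv]
  rfl

/-- The fibre component of a vertical lift. -/
theorem mfderiv_trivialization_snd_vertical (a : TotalSpace F E) (b : E a.proj) :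
    mfderiv ((𝓡 n).prod 𝓘(ℝ, F)) 𝓘(ℝ, F)
      (fun c : TotalSpace F E => (trivializationAt F E a.proj c).2) a (vertical a b) =
      (trivializationAt F E a.proj ⟨a.proj, b⟩).2 := by
  have hs := (contMDiffAt_trivialization_snd (n := n) (m := a.proj) (a := a)
    (mem_baseSet_trivializationAt F E a.proj)).mdifferentiableAt (by simp)
  rw [← mfderiv_vertical b hs, mfderiv_eq_fderiv]
  have hl := (trivializationAt F E a.proj).linear ℝ (mem_baseSet_trivializationAt F E a.proj)
  have : (fun t : ℝ => (trivializationAt F E a.proj ⟨a.proj, a.snd + t • b⟩).2) =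
      fun t : ℝ => (trivializationAt F E a.proj ⟨a.proj, a.snd⟩).2 +
        t • (trivializationAt F E a.proj ⟨a.proj, b⟩).2 := by
    funext t
    rw [hl.map_add, hl.map_smul]
  rw [this]
  have hd : HasDerivAt (fun t : ℝ => (trivializationAt F E a.proj ⟨a.proj, a.snd⟩).2 +
        t • (trivializationAt F E a.proj ⟨a.proj, b⟩).2)
      ((1 : ℝ) • (trivializationAt F E a.proj ⟨a.proj, b⟩).2) 0 :=
    ((hasDerivAt_id (0 : ℝ)).smul_const _).const_add _
  rw [one_smul] at hd
  exact hd.deriv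

/-- The defining curves do not add in the total space, so linearity is read off in a trivialization:
the base component vanishes and the fibre coordinate is linear on fibres. -/
theorem vertical_add (a : TotalSpace F E) (b c : E a.proj) :
    vertical (n := n) a (b + c) = vertical a b + vertical a c := by
  have hl := (trivializationAt F E a.proj).linear ℝ (mem_baseSet_trivializationAt F E a.proj)
  refine totalSpace_tangent_ext ?_ ?_
  · rw [map_add]
    simp only [mfderiv_proj_vertical, add_zero]
  · rw [map_add]
    simp only [mfderiv_trivialization_snd_vertical]
    exact hl.map_add b c

theorem vertical_smul (a : TotalSpace F E) (t : ℝ) (b : E a.proj) :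
    vertical (n := n) a (t • b) = t • vertical a b := by
  have hl := (trivializationAt F E a.proj).linear ℝ (mem_baseSet_trivializationAt F E a.proj)
  refine totalSpace_tangent_ext ?_ ?_
  · rw [map_smul]
    simp only [mfderiv_proj_vertical, smul_zero]
  · rw [map_smul]
    simp only [mfderiv_trivialization_snd_vertical]
    exact hl.map_smul t b

theorem vertical_injective (a : TotalSpace F E) :
    Function.Injective (vertical (n := n) a) := by
  intro b c h
  have h1 := mfderiv_trivialization_snd_vertical (n := n) a b
  rw [h, mfderiv_trivialization_snd_vertical] at h1
  have h2 := ((trivializationAt F E a.proj).continuousLinearEquivAt ℝ a.proj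
    (mem_baseSet_trivializationAt F E a.proj)).injective (a₁ := c) (a₂ := b)
  exact (h2 h1).symm

/-- The tangent vectors in the kernel of `Tτ` are the vertical lifts. -/
theorem exists_eq_vertical {a : TotalSpace F E} {v : TangentSpace ((𝓡 n).prod 𝓘(ℝ, F)) a}
    (hv : mfderiv ((𝓡 n).prod 𝓘(ℝ, F)) (𝓡 n) (TotalSpace.proj : TotalSpace F E → M) a v = 0) :
    ∃ b : E a.proj, v = vertical a b := by
  set w : F := mfderiv ((𝓡 n).prod 𝓘(ℝ, F)) 𝓘(ℝ, F)
      (fun c : TotalSpace F E => (trivializationAt F E a.proj c).2) a v with hw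
  obtain ⟨b, hb⟩ := ((trivializationAt F E a.proj).continuousLinearEquivAt ℝ a.proj
    (mem_baseSet_trivializationAt F E a.proj)).surjective w
  refine ⟨b, totalSpace_tangent_ext ?_ ?_⟩
  · rw [hv, mfderiv_proj_vertical]
  · rw [mfderiv_trivialization_snd_vertical]
    exact hb.symm

/-- The Legendre transformation of `L`: the fibre derivative `b ↦ dL(b_aⱽ)`. -/
def legendre (L : TotalSpace F E → ℝ) (a : TotalSpace F E) : E a.proj →ₗ[ℝ] ℝ where
  toFun b := dirDeriv ((𝓡 n).prod 𝓘(ℝ, F)) L a (vertical a b)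
  map_add' b c := by rw [vertical_add, dirDeriv_map_add]
  map_smul' t b := by rw [vertical_smul, dirDeriv_map_smul]; rfl

section AlongMap

variable {H V N : Type*} [TopologicalSpace H] [NormedAddCommGroup V] [NormedSpace ℝ V]
  {I : ModelWithCorners ℝ V H} [TopologicalSpace N] [ChartedSpace H N] [IsManifold I ∞ N]

/-- The pairing is the derivative at `t = 0` of `L (c x + t • s x)`, which is jointly smooth in `(x,
t)`; such a partial derivative is smooth in `x`. -/
theorem contMDiff_legendre {L : TotalSpace F E → ℝ}
    (hL : ContMDiff ((𝓡 n).prod 𝓘(ℝ, F)) 𝓘(ℝ, ℝ) ∞ L) {c : N → TotalSpace F E}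
    {s : Π x, E (c x).proj} (hc : ContMDiff I ((𝓡 n).prod 𝓘(ℝ, F)) ∞ c)
    (hs : ContMDiff I ((𝓡 n).prod 𝓘(ℝ, F)) ∞ (fun x => (⟨(c x).proj, s x⟩ : TotalSpace F E))) :
    ContMDiff I 𝓘(ℝ, ℝ) ∞ (fun x => legendre (n := n) L (c x) (s x)) := by
  let G : N × ℝ → ℝ := fun p => L ⟨(c p.1).proj, (c p.1).snd + p.2 • s p.1⟩
  have hG : ContMDiff (I.prod 𝓘(ℝ, ℝ)) 𝓘(ℝ, ℝ) ∞ G := by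
    refine hL.comp ?_
    exact contMDiff_add_smul (q := fun p : N × ℝ => (c p.1).proj) (s := fun p => (c p.1).snd)
      (t := fun p => s p.1) (c := fun p => p.2) (hc.comp contMDiff_fst) (hs.comp contMDiff_fst)
      contMDiff_snd
  intro x
  have h := ContMDiffAt.mfderiv_apply (I := 𝓘(ℝ, ℝ)) (I' := 𝓘(ℝ, ℝ)) (J := I) (J' := I)
    (m := ∞) (n := ∞) (x₀ := x) (fun x t => G (x, t)) (fun _ => (0 : ℝ)) id (fun _ => (1 : ℝ))
    (by exact hG _) contMDiffAt_const contMDiffAt_id contMDiffAt_const (by simp)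
  refine h.congr_of_eventuallyEq (Eventually.of_forall fun y => ?_)
  change dirDeriv ((𝓡 n).prod 𝓘(ℝ, F)) L (c y) (vertical (c y) (s y)) = _
  rw [dirDeriv, ← mfderiv_vertical (s y) (hL.mdifferentiableAt (by simp))]
  exact congrArg (fun T : ℝ →L[ℝ] ℝ => T 1) (congrFun (inTangentCoordinates_model_space
    (I := 𝓘(ℝ, ℝ)) (I' := 𝓘(ℝ, ℝ)) (fun _ : N => (0 : ℝ)) (fun x => G (x, 0))
    (fun x => mfderiv 𝓘(ℝ, ℝ) 𝓘(ℝ, ℝ) (fun t => G (x, t)) 0) x) y).symm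

end AlongMap

end LieAlgebroid

/-! ### Cut-offs, local frames and projectable sections -/

/-- A local section multiplied by a smooth function which vanishes off a closed subset of its
domain is smooth. -/
theorem contMDiff_cutoff_section {HB VB B : Type*} [TopologicalSpace HB] [NormedAddCommGroup VB]
    [NormedSpace ℝ VB] {IB : ModelWithCorners ℝ VB HB} [TopologicalSpace B] [ChartedSpace HB B]
    {G : Type*} [NormedAddCommGroup G] [NormedSpace ℝ G]
    {W : B → Type*} [TopologicalSpace (TotalSpace G W)] [∀ x, TopologicalSpace (W x)]
    [FiberBundle G W] [∀ x, AddCommGroup (W x)] [∀ x, Module ℝ (W x)] [VectorBundle ℝ G W]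
    {g : B → ℝ} (hg : ContMDiff IB 𝓘(ℝ, ℝ) ∞ g) {K : Set B} (hK : IsClosed K)
    (hgK : ∀ x ∉ K, g x = 0) {s : Π x, W x}
    (hs : ∀ x ∈ K, ContMDiffAt IB (IB.prod 𝓘(ℝ, G)) ∞ (fun x => (⟨x, s x⟩ : TotalSpace G W)) x) :
    ContMDiff IB (IB.prod 𝓘(ℝ, G)) ∞ (fun x => (⟨x, g x • s x⟩ : TotalSpace G W)) := by
  intro y
  by_cases hy : y ∈ K
  · exact (hg y).smul_section (hs y hy)
  · have h0 : ContMDiffAt IB (IB.prod 𝓘(ℝ, G)) ∞ (fun y => (⟨y, 0⟩ : TotalSpace G W)) y :=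
      contMDiff_zeroSection ℝ W y
    refine h0.congr_of_eventuallyEq ?_
    filter_upwards [hK.isOpen_compl.mem_nhds hy] with z hz
    simp [hgK z hz]

theorem contMDiff_cutoff_fun {HB VB B : Type*} [TopologicalSpace HB] [NormedAddCommGroup VB]
    [NormedSpace ℝ VB] {IB : ModelWithCorners ℝ VB HB} [TopologicalSpace B] [ChartedSpace HB B]
    {g : B → ℝ} (hg : ContMDiff IB 𝓘(ℝ, ℝ) ∞ g) {K : Set B} (hK : IsClosed K)
    (hgK : ∀ x ∉ K, g x = 0) {s : B → ℝ} (hs : ∀ x ∈ K, ContMDiffAt IB 𝓘(ℝ, ℝ) ∞ s x) :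
    ContMDiff IB 𝓘(ℝ, ℝ) ∞ (fun x => g x * s x) := by
  intro y
  by_cases hy : y ∈ K
  · exact (hg y).mul (hs y hy)
  · refine (contMDiffAt_const (c := (0 : ℝ))).congr_of_eventuallyEq ?_
    filter_upwards [hK.isOpen_compl.mem_nhds hy] with z hz
    simp [hgK z hz]

theorem exists_bump_tsupport_subset {m : M} {U : Set M} (hU : U ∈ 𝓝 m) :
    ∃ χ : M → ℝ, ContMDiff (𝓡 n) 𝓘(ℝ, ℝ) ∞ χ ∧ tsupport χ ⊆ U ∧ ∀ᶠ x in 𝓝 m, χ x = 1 := by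
  obtain ⟨χ, -, hχ⟩ := (SmoothBumpFunction.nhds_basis_tsupport (I := 𝓡 n) m).mem_iff.1 hU
  exact ⟨χ, χ.contMDiff, hχ, χ.eventuallyEq_one⟩

theorem exists_totalSpace_bump {a : TotalSpace F E} {U : Set (TotalSpace F E)} (hU : U ∈ 𝓝 a) :
    ∃ χ : TotalSpace F E → ℝ, ContMDiff ((𝓡 n).prod 𝓘(ℝ, F)) 𝓘(ℝ, ℝ) ∞ χ ∧ tsupport χ ⊆ U ∧
      ∀ᶠ x in 𝓝 a, χ x = 1 := by
  have := t2Space_totalSpace F E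
  have : IsManifold ((𝓡 n).prod 𝓘(ℝ, F)) ∞ (TotalSpace F E) := inferInstance
  obtain ⟨χ, -, hχ⟩ :=
    (SmoothBumpFunction.nhds_basis_tsupport (I := (𝓡 n).prod 𝓘(ℝ, F)) a).mem_iff.1 hU
  exact ⟨χ, χ.contMDiff, hχ, χ.eventuallyEq_one⟩

/-- Near every point there are global smooth sections `e i` and global smooth fibrewise linear
functions `ε i` such that `b = ∑ ε i (b) e i` for all `b` over a neighbourhood. -/
theorem exists_local_frame (m : M) :
    ∃ (k : ℕ) (e : Fin k → Cₛ^∞⟮𝓡 n; F, E⟯) (ε : Fin k → Π x, E x →ₗ[ℝ] ℝ),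
      (∀ i, ContMDiff ((𝓡 n).prod 𝓘(ℝ, F)) 𝓘(ℝ, ℝ) ∞
        (fun a : TotalSpace F E => ε i a.proj a.snd)) ∧
      ∀ᶠ x in 𝓝 m, ∀ b : E x, b = ∑ i, ε i x b • e i x := by
  set T := trivializationAt F E m with hT
  have hm : m ∈ T.baseSet := mem_baseSet_trivializationAt F E m
  obtain ⟨χ, hχ, hχT, hχ1⟩ := exists_bump_tsupport_subset (n := n) (T.open_baseSet.mem_nhds hm)
  have hχ0 : ∀ x ∉ tsupport χ, χ x = 0 := fun x hx => image_eq_zero_of_notMem_tsupport hx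
  let b := Module.finBasis ℝ F
  have hτ : ContMDiff ((𝓡 n).prod 𝓘(ℝ, F)) (𝓡 n) ∞ (TotalSpace.proj : TotalSpace F E → M) :=
    contMDiff_proj E
  -- Frame and coframe of the trivialization are both cut off to become global; the expansion of a
  -- vector survives where `χ = 1`.
  refine ⟨Module.finrank ℝ F, fun i => ⟨fun x => χ x • T.symmₗ ℝ x (b i), ?_⟩,
    fun i x => χ x • (b.coord i ∘ₗ T.linearMapAt ℝ x), fun i => ?_, ?_⟩
  · refine contMDiff_cutoff_section hχ (isClosed_tsupport χ) hχ0 fun x hx => ?_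
    rw [T.contMDiffAt_section_iff (hχT hx)]
    refine (contMDiffAt_const (c := b i)).congr_of_eventuallyEq ?_
    filter_upwards [T.open_baseSet.mem_nhds (hχT hx)] with y hy
    rw [T.symmₗ_apply hy, T.apply_mk_symm hy]
  · refine contMDiff_cutoff_fun (g := fun a : TotalSpace F E => χ a.proj) (hχ.comp hτ)
      ((isClosed_tsupport χ).preimage hτ.continuous) (fun a ha => hχ0 _ ha)
      (s := fun a : TotalSpace F E => b.coord i (T.linearMapAt ℝ a.proj a.snd)) fun a ha => ?_
    have h1 := contMDiffAt_trivialization_snd (n := n) (m := m) (hχT ha)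
    let l : F →L[ℝ] ℝ := (b.coord i).toContinuousLinearMap
    refine (l.contMDiff.contMDiffAt.comp a h1).congr_of_eventuallyEq ?_
    filter_upwards [hτ.continuous.continuousAt.preimage_mem_nhds
      (T.open_baseSet.mem_nhds (hχT ha))] with c hc
    have hc' : c.proj ∈ T.baseSet := hc
    rw [T.coe_linearMapAt_of_mem hc']
    rfl
  · filter_upwards [hχ1, T.open_baseSet.mem_nhds hm] with x hx hxT y
    simp only [ContMDiffSection.coeFn_mk, LinearMap.comp_apply, hx, one_smul]
    simp only [← map_smul, ← map_sum, Module.Basis.coord_apply, b.sum_repr,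
      T.symmₗ_linearMapAt hxT]

namespace LieAlgebroid

variable (A : LieAlgebroid n F E)

/-- Every element of the prolongation is the value of a projectable section. -/
theorem exists_projectable {a : TotalSpace F E} (z : A.Prolongation a) :
    ∃ Z : A.ProjectableSection, Z.eval a = z := by
  set T := trivializationAt F E a.proj with hT
  have hm : a.proj ∈ T.baseSet := mem_baseSet_trivializationAt F E a.proj
  have ha : a ∈ T.source := T.mem_source.2 hm
  obtain ⟨χ, hχ, hχT, hχ1⟩ := exists_bump_tsupport_subset (n := n) (T.open_baseSet.mem_nhds hm)
  have hχ0 : ∀ x ∉ tsupport χ, χ x = 0 := fun x hx => image_eq_zero_of_notMem_tsupport hx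
  have hτ : ContMDiff ((𝓡 n).prod 𝓘(ℝ, F)) (𝓡 n) ∞ (TotalSpace.proj : TotalSpace F E → M) :=
    contMDiff_proj E
  obtain ⟨σ, hσ⟩ := exists_section_through (n := n) (F := F) z.1.1
  have hd : T.toOpenPartialHomeomorph.MDifferentiable ((𝓡 n).prod 𝓘(ℝ, F))
      ((𝓡 n).prod 𝓘(ℝ, F)) :=
    ⟨(T.contMDiffOn (n := ∞)).mdifferentiableOn (by simp),
      (T.contMDiffOn_symm (n := ∞)).mdifferentiableOn (by simp)⟩
  have hinv : ∀ b ∈ T.source,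
      (mfderiv ((𝓡 n).prod 𝓘(ℝ, F)) ((𝓡 n).prod 𝓘(ℝ, F)) T b).IsInvertible :=
    fun b hb => ⟨hd.mfderiv hb, rfl⟩
  -- In the trivialization the fibre component can be kept constant; only the base component has to
  -- follow the anchor of `σ`.
  let w : F := (mfderiv ((𝓡 n).prod 𝓘(ℝ, F)) ((𝓡 n).prod 𝓘(ℝ, F)) T a z.1.2).2
  let V : Π p : M × F, TangentSpace ((𝓡 n).prod 𝓘(ℝ, F)) p :=
    fun p => (A.anchor p.1 (σ p.1), w)
  have hV : ContMDiff ((𝓡 n).prod 𝓘(ℝ, F)) ((𝓡 n).prod 𝓘(ℝ, F)).tangent ∞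
      (fun p => (⟨p, V p⟩ : TangentBundle ((𝓡 n).prod 𝓘(ℝ, F)) (M × F))) := by
    have h1 : ContMDiff ((𝓡 n).prod 𝓘(ℝ, F)) (𝓡 n).tangent ∞
        (fun p : M × F => (⟨p.1, A.anchor p.1 (σ p.1)⟩ : TangentBundle (𝓡 n) M)) :=
      (A.anchor_section_smooth σ).comp contMDiff_fst
    have h2 : ContMDiff ((𝓡 n).prod 𝓘(ℝ, F)) 𝓘(ℝ, F).tangent ∞
        (fun p : M × F => (⟨p.2, w⟩ : TangentBundle 𝓘(ℝ, F) F)) :=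
      (contMDiff_vectorSpace_iff_contDiff.2 contDiff_const).comp contMDiff_snd
    exact contMDiff_equivTangentBundleProd_symm.comp (h1.prodMk h2)
  let X := mpullback ((𝓡 n).prod 𝓘(ℝ, F)) ((𝓡 n).prod 𝓘(ℝ, F)) T V
  have hTX : ∀ b ∈ T.source,
      mfderiv ((𝓡 n).prod 𝓘(ℝ, F)) ((𝓡 n).prod 𝓘(ℝ, F)) T b (X b) = V (T b) :=
    fun b hb => (hinv b hb).self_apply_inverse _
  have hfst : ∀ b ∈ T.source, ∀ v : TangentSpace ((𝓡 n).prod 𝓘(ℝ, F)) b,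
      (mfderiv ((𝓡 n).prod 𝓘(ℝ, F)) ((𝓡 n).prod 𝓘(ℝ, F)) T b v).1 =
      mfderiv ((𝓡 n).prod 𝓘(ℝ, F)) (𝓡 n) (TotalSpace.proj : TotalSpace F E → M) b v := by
    intro b hb v
    have hev : (TotalSpace.proj : TotalSpace F E → M) =ᶠ[𝓝 b] Prod.fst ∘ T := by
      filter_upwards [T.open_source.mem_nhds hb] with c hc
      exact (T.coe_fst hc).symm
    have h := mfderiv_comp b (mdifferentiableAt_fst (I := 𝓡 n) (I' := 𝓘(ℝ, F)) (x := T b))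
      (hd.mdifferentiableAt hb)
    rw [mfderiv_fst] at h
    rw [hev.mfderiv_eq]
    exact (congrArg (fun S => S v) h).symm
  -- The cut-off is pulled back from the base and multiplies both components, so the result is still
  -- projectable and still satisfies the anchor condition.
  refine ⟨⟨⟨fun x => χ x • σ x, hχ.smul_section σ.contMDiff⟩, fun b => χ b.proj • X b, ?_, ?_⟩, ?_⟩
  · refine contMDiff_cutoff_section (g := fun b : TotalSpace F E => χ b.proj) (hχ.comp hτ)
      ((isClosed_tsupport χ).preimage hτ.continuous) (fun b hb => hχ0 _ hb) fun b hb => ?_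
    have hb' : b ∈ T.source := T.mem_source.2 (hχT hb)
    exact ContMDiffAt.mpullback_vectorField_preimage (m := ∞) (n := ∞) (hV (T b))
      (T.contMDiffOn.contMDiffAt (T.open_source.mem_nhds hb')) (hinv b hb') le_rfl
  · intro b
    change A.anchor b.proj (χ b.proj • σ b.proj) =
      mfderiv ((𝓡 n).prod 𝓘(ℝ, F)) (𝓡 n) (TotalSpace.proj : TotalSpace F E → M) b
        (χ b.proj • X b)
    rw [map_smul, map_smul]
    by_cases hb : b.proj ∈ tsupport χ
    · have hb' : b ∈ T.source := T.mem_source.2 (hχT hb)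
      have h1 := hfst b hb' (X b)
      rw [hTX b hb'] at h1
      have h2 : A.anchor (T b).1 (σ (T b).1) = mfderiv ((𝓡 n).prod 𝓘(ℝ, F)) (𝓡 n)
        (TotalSpace.proj : TotalSpace F E → M) b (X b) := h1
      rw [T.coe_fst hb'] at h2
      rw [h2]
    · rw [hχ0 _ hb, zero_smul, zero_smul]
  · have hχa : χ a.proj = 1 := hχ1.self_of_nhds
    refine Subtype.ext (Prod.ext ?_ ?_)
    · change χ a.proj • σ a.proj = _
      rw [hχa, one_smul, hσ]
    · change χ a.proj • X a = _
      rw [hχa, one_smul]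
      refine (hinv a ha).injective ?_
      rw [hTX a ha]
      have h1 := hfst a ha z.1.2
      rw [← (z.2 : A.anchor a.proj z.1.1 = _), ← hσ] at h1
      refine Prod.ext ?_ rfl
      change A.anchor (T a).1 (σ (T a).1) = _
      rw [h1, T.coe_fst ha]

end LieAlgebroid

/-! ### The tangent spaces of a subbundle -/

theorem contDiff_matrix_det {ι : Type*} [Fintype ι] [DecidableEq ι] :
    ContDiff ℝ ∞ (fun B : ι → ι → ℝ => Matrix.det (Matrix.of B)) := by
  simp only [Matrix.det_apply, Matrix.of_apply]
  refine ContDiff.sum fun σ _ => ContDiff.const_smul _ (contDiff_prod fun i _ => ?_)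
  exact contDiff_apply_apply ℝ ℝ (σ i) i

/-- The derivative of a section is a right inverse of the derivative of the projection. -/
theorem mfderiv_proj_mfderiv_section (σ : Cₛ^∞⟮𝓡 n; F, E⟯) (x : M) (u : TangentSpace (𝓡 n) x) :
    mfderiv ((𝓡 n).prod 𝓘(ℝ, F)) (𝓡 n) (TotalSpace.proj : TotalSpace F E → M) ⟨x, σ x⟩
      (mfderiv (𝓡 n) ((𝓡 n).prod 𝓘(ℝ, F)) (fun x => (⟨x, σ x⟩ : TotalSpace F E)) x u) = u := by
  have h1 := mfderiv_comp x (g := (TotalSpace.proj : TotalSpace F E → M)) (I'' := 𝓡 n)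
    ((contMDiff_proj E (n := ∞)).mdifferentiableAt (by simp))
    (σ.contMDiff.mdifferentiableAt (x := x) (by simp))
  have h2 := congrArg (fun S => S u) h1
  refine h2.symm.trans ?_
  have h3 : mfderiv (𝓡 n) (𝓡 n) ((TotalSpace.proj : TotalSpace F E → M) ∘
      fun x => (⟨x, σ x⟩ : TotalSpace F E)) x = ContinuousLinearMap.id ℝ _ := mfderiv_id
  exact congrArg (fun S => S u) h3

/-- The derivative of any section through `a` provides a lift. -/
theorem mfderiv_proj_surjective (a : TotalSpace F E) (u : TangentSpace (𝓡 n) a.proj) :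
    ∃ v : TangentSpace ((𝓡 n).prod 𝓘(ℝ, F)) a,
      mfderiv ((𝓡 n).prod 𝓘(ℝ, F)) (𝓡 n) (TotalSpace.proj : TotalSpace F E → M) a v = u := by
  obtain ⟨m, b⟩ := a
  obtain ⟨σ, rfl⟩ := exists_section_through (n := n) (F := F) b
  exact ⟨_, mfderiv_proj_mfderiv_section σ m u⟩

namespace Subbundle

open LieAlgebroid

variable {D : Subbundle n F E}

/-- Every vector of a subbundle extends to a smooth section which lies locally in the subbundle. -/
theorem exists_local_section {a : TotalSpace F E} (ha : a ∈ D.carrier) :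
    ∃ σ : Cₛ^∞⟮𝓡 n; F, E⟯, σ a.proj = a.snd ∧ ∀ᶠ y in 𝓝 a.proj, σ y ∈ D.fiber y := by
  obtain ⟨k, s, hs⟩ := D.exists_frame a.proj
  have h1 : a.snd ∈ Submodule.span ℝ (range fun i => s i a.proj) := by
    rw [hs.self_of_nhds.2]; exact ha
  obtain ⟨c, hc⟩ := (Submodule.mem_span_range_iff_exists_fun ℝ).1 h1
  have hv : ∀ y, (∑ i, c i • s i) y = ∑ i, c i • s i y := by
    intro y
    exact map_sum (⟨⟨fun τ : Cₛ^∞⟮𝓡 n; F, E⟯ => τ y, rfl⟩, fun _ _ => rfl⟩ :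
      Cₛ^∞⟮𝓡 n; F, E⟯ →+ E y) (fun i => c i • s i) Finset.univ
  refine ⟨∑ i, c i • s i, by rw [hv, hc], ?_⟩
  filter_upwards [hs] with y hy
  rw [hv, ← hy.2]
  exact Submodule.sum_mem _ fun i _ => Submodule.smul_mem _ _ (Submodule.subset_span ⟨i, rfl⟩)

/-- The tangent space of a subbundle projects onto the tangent space of the base. -/
theorem exists_tangent_lift {a : TotalSpace F E} (ha : a ∈ D.carrier)
    (u : TangentSpace (𝓡 n) a.proj) :
    ∃ v ∈ D.tangent a,
      mfderiv ((𝓡 n).prod 𝓘(ℝ, F)) (𝓡 n) (TotalSpace.proj : TotalSpace F E → M) a v = u := by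
  obtain ⟨σ, hσ, hσD⟩ := exists_local_section ha
  obtain ⟨m, b⟩ := a
  obtain rfl : σ m = b := hσ
  have hd : MDifferentiableAt (𝓡 n) ((𝓡 n).prod 𝓘(ℝ, F))
      (fun x => (⟨x, σ x⟩ : TotalSpace F E)) m := σ.contMDiff.mdifferentiableAt (by simp)
  refine ⟨mfderiv (𝓡 n) ((𝓡 n).prod 𝓘(ℝ, F)) (fun x => (⟨x, σ x⟩ : TotalSpace F E)) m u,
    fun f hf h0 => ?_, ?_⟩
  · have h1 := dirDeriv_comp (f := f) (x := m) (hf.mdifferentiableAt (by simp)) hd u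
    refine h1.symm.trans ?_
    have h2 : (fun y => f ⟨y, σ y⟩) =ᶠ[𝓝 m] fun _ => 0 := by
      filter_upwards [hσD] with y hy
      exact h0 _ hy
    rw [dirDeriv_congr h2, dirDeriv, mfderiv_const]
    rfl
  · exact mfderiv_proj_mfderiv_section σ m u

/-- The line `a + t c` stays in `D`, so functions vanishing on `D` are constant along it. -/
theorem vertical_mem_tangent {a : TotalSpace F E} (ha : a ∈ D.carrier) {c : E a.proj}
    (hc : c ∈ D.fiber a.proj) : vertical a c ∈ D.tangent a := by
  intro f hf h0
  rw [dirDeriv_vertical c (hf.mdifferentiableAt (by simp))]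
  have : (fun t : ℝ => f ⟨a.proj, a.snd + t • c⟩) = fun _ => 0 :=
    funext fun t => h0 _ (Submodule.add_mem _ ha (Submodule.smul_mem _ _ hc))
  rw [this, deriv_const]

/-- The derivatives along `T_aD` of a function which vanishes on `D` near `a` are zero. -/
theorem dirDeriv_eq_zero_of_mem_tangent {a : TotalSpace F E}
    {v : TangentSpace ((𝓡 n).prod 𝓘(ℝ, F)) a} (hv : v ∈ D.tangent a) {f : TotalSpace F E → ℝ}
    (hf : ContMDiff ((𝓡 n).prod 𝓘(ℝ, F)) 𝓘(ℝ, ℝ) ∞ f)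
    (h0 : ∀ᶠ d in 𝓝 a, d ∈ D.carrier → f d = 0) :
    dirDeriv ((𝓡 n).prod 𝓘(ℝ, F)) f a v = 0 := by
  -- `tangent` tests only against functions vanishing on all of `D`; a bump function turns local
  -- vanishing into global vanishing without changing the derivative at `a`.
  obtain ⟨χ, hχ, hχU, hχ1⟩ := exists_totalSpace_bump (n := n)
    (U := {d | d ∈ D.carrier → f d = 0}) h0
  have h1 : f =ᶠ[𝓝 a] fun d => χ d * f d := by
    filter_upwards [hχ1] with d hd
    rw [hd, one_mul]
  rw [dirDeriv_congr h1]
  refine hv _ (hχ.mul hf) fun d hd => ?_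
  by_cases hdχ : d ∈ tsupport χ
  · rw [hχU hdχ hd, mul_zero]
  · rw [image_eq_zero_of_notMem_tsupport hdχ, zero_mul]

/-- The vertical vectors tangent to a subbundle are the vertical lifts of its elements. -/
theorem mem_of_vertical_mem_tangent {a : TotalSpace F E} (ha : a ∈ D.carrier) {c : E a.proj}
    (hc : vertical (n := n) a c ∈ D.tangent a) : c ∈ D.fiber a.proj := by
  classical
  -- If `c` is outside `D`, a determinant gives a smooth function that vanishes on `D` and has
  -- derivative 1 along the vertical lift of `c`, contradicting tangency.
  by_contra hcD
  obtain ⟨k, s, hs⟩ := D.exists_frame a.proj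
  set T := trivializationAt F E a.proj with hT
  have hm : a.proj ∈ T.baseSet := mem_baseSet_trivializationAt F E a.proj
  have hlin : LinearIndependent ℝ (fun o : Option (Fin k) => o.elim c (fun i => s i a.proj)) := by
    have h1 := linearIndependent_option (K := ℝ) (v := fun o : Option (Fin k) =>
      o.elim c (fun i => s i a.proj))
    refine h1.2 ⟨hs.self_of_nhds.1, ?_⟩
    have h2 := hs.self_of_nhds.2
    change c ∉ Submodule.span ℝ (range fun i => s i a.proj)
    rwa [h2]
  -- the coordinates of a vector in the fibre over `x`
  let u : M → F → Option (Fin k) → F := fun x w o => o.elim w (fun i => T.linearMapAt ℝ x (s i x))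
  have hu : LinearIndependent ℝ (u a.proj (T.linearMapAt ℝ a.proj c)) := by
    have h1 := hlin.map' (T.linearEquivAt ℝ a.proj hm).toLinearMap (LinearEquiv.ker _)
    have h2 : u a.proj (T.linearMapAt ℝ a.proj c) = (T.linearEquivAt ℝ a.proj hm).toLinearMap ∘
        fun o : Option (Fin k) => o.elim c (fun i => s i a.proj) := by
      funext o
      rcases o with _ | i <;> simp [u, T.linearMapAt_def_of_mem hm]
    rw [h2]
    exact h1
  -- `φ` reads off coefficients with respect to `c` and the frame at the base point, and is used
  -- unchanged at nearby points. In `B` the row `none` holds the variable vector and the other rows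
  -- hold the frame, so the determinant is linear in the vector and equals 1 at `c`.
  obtain ⟨φ, hφ⟩ := LinearMap.exists_leftInverse_of_injective
    (Fintype.linearCombination ℝ (u a.proj (T.linearMapAt ℝ a.proj c)))
    (LinearMap.ker_eq_bot.2 hu.fintypeLinearCombination_injective)
  have hφu : ∀ o, φ (u a.proj (T.linearMapAt ℝ a.proj c) o) = Pi.single o 1 := by
    intro o
    have := congrArg (fun S => S (Pi.single o (1 : ℝ))) hφ
    simpa using this
  let B : M → F → Matrix (Option (Fin k)) (Option (Fin k)) ℝ :=
    fun x w => Matrix.of fun o => φ (u x w o)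
  have hB1 : (B a.proj (T.linearMapAt ℝ a.proj c)).det = 1 := by
    have : B a.proj (T.linearMapAt ℝ a.proj c) = 1 := by
      ext o p
      simp only [B, Matrix.of_apply, hφu, Matrix.one_apply, Pi.single_apply, eq_comm]
    rw [this, Matrix.det_one]
  have hBupd : ∀ x w, B x w = (B x 0).updateRow none (φ w) := by
    intro x w
    ext o p
    rcases o with _ | i <;> simp [B, u, Matrix.updateRow_apply]
  have hBlin : ∀ x w w' (t : ℝ), (B x (w + t • w')).det = (B x w).det + t * (B x w').det := by
    intro x w w' t
    rw [hBupd x (w + t • w'), hBupd x w, hBupd x w', map_add, map_smul, Matrix.det_updateRow_add,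
      Matrix.det_updateRow_smul]
  have hU : {y | y ∈ T.baseSet ∧ Submodule.span ℝ (range fun i => s i y) = D.fiber y} ∈
      𝓝 a.proj := by
    filter_upwards [hs, T.open_baseSet.mem_nhds hm] with y hy hyT
    exact ⟨hyT, hy.2⟩
  obtain ⟨χ, hχ, hχU, hχ1⟩ := exists_bump_tsupport_subset (n := n) hU
  have hχ0 : ∀ x ∉ tsupport χ, χ x = 0 := fun x hx => image_eq_zero_of_notMem_tsupport hx
  have hτ : ContMDiff ((𝓡 n).prod 𝓘(ℝ, F)) (𝓡 n) ∞ (TotalSpace.proj : TotalSpace F E → M) :=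
    contMDiff_proj E
  let f : TotalSpace F E → ℝ := fun d => χ d.proj * (B d.proj (T.linearMapAt ℝ d.proj d.snd)).det
  have hf : ContMDiff ((𝓡 n).prod 𝓘(ℝ, F)) 𝓘(ℝ, ℝ) ∞ f := by
    refine contMDiff_cutoff_fun (g := fun a : TotalSpace F E => χ a.proj) (hχ.comp hτ)
      ((isClosed_tsupport χ).preimage hτ.continuous) (fun a ha => hχ0 _ ha) fun d hd => ?_
    have hdT : d.proj ∈ T.baseSet := (hχU hd).1
    refine (contDiff_matrix_det.contMDiff (n := ∞)).contMDiffAt.comp d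
      (g := fun B : Option (Fin k) → Option (Fin k) → ℝ => Matrix.det (Matrix.of B))
      (f := fun d : TotalSpace F E => fun o => φ (u d.proj (T.linearMapAt ℝ d.proj d.snd) o)) ?_
    refine contMDiffAt_pi_space.2 fun o => ?_
    have hφs : ContMDiff 𝓘(ℝ, F) 𝓘(ℝ, Option (Fin k) → ℝ) ∞ φ :=
      φ.toContinuousLinearMap.contMDiff
    refine hφs.contMDiffAt.comp d ?_
    have hev : ∀ᶠ b : TotalSpace F E in 𝓝 d, b.proj ∈ T.baseSet :=
      hτ.continuous.continuousAt.preimage_mem_nhds (T.open_baseSet.mem_nhds hdT)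
    rcases o with _ | i
    · refine (contMDiffAt_trivialization_snd (n := n) (m := a.proj) hdT).congr_of_eventuallyEq ?_
      filter_upwards [hev] with b hb
      change T.linearMapAt ℝ b.proj b.snd = (T b).2
      rw [T.coe_linearMapAt_of_mem hb]
    · have h1 := (contMDiffAt_trivialization_snd (n := n) (m := a.proj)
        (a := (⟨d.proj, s i d.proj⟩ : TotalSpace F E)) hdT).comp d
        ((s i).contMDiff.comp hτ).contMDiffAt
      refine h1.congr_of_eventuallyEq ?_
      filter_upwards [hev] with b hb
      change T.linearMapAt ℝ b.proj (s i b.proj) = (T ⟨b.proj, s i b.proj⟩).2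
      rw [T.coe_linearMapAt_of_mem hb]
  have hfD : ∀ d ∈ D.carrier, f d = 0 := by
    intro d hd
    by_cases hdχ : d.proj ∈ tsupport χ
    · obtain ⟨hdT, hds⟩ := hχU hdχ
      have h1 : d.snd ∈ Submodule.span ℝ (range fun i => s i d.proj) := by
        rw [hds]; exact hd
      obtain ⟨y, hy⟩ := (Submodule.mem_span_range_iff_exists_fun ℝ).1 h1
      have : (B d.proj (T.linearMapAt ℝ d.proj d.snd)).det = 0 := by
        -- A vector of `D` is a combination of the frame with coefficients `y`; the entry `-1` on
        -- its own row turns this into a nontrivial relation between the rows.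
        refine Matrix.exists_vecMul_eq_zero_iff.1
          ⟨fun o => o.elim (-1) y, fun h => by simpa using congrFun h none, ?_⟩
        ext p
        simp only [Matrix.vecMul, dotProduct, Fintype.sum_option, Option.elim, B, Matrix.of_apply,
          u, ← hy, map_sum, map_smul, Finset.sum_apply, Pi.smul_apply, smul_eq_mul, Pi.zero_apply]
        ring
      simp [f, this]
    · simp [f, hχ0 _ hdχ]
  have h := hc f hf hfD
  rw [dirDeriv_vertical c (hf.mdifferentiableAt (by simp))] at h
  -- The cut-off depends only on the base point and is 1 there; by linearity the determinant is 0 at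
  -- `a` and grows by `t` times its value at `c`.
  have hline : (fun t : ℝ => f ⟨a.proj, a.snd + t • c⟩) = fun t : ℝ => t := by
    funext t
    have h0 : f a = 0 := hfD a ha
    have hχa : χ a.proj = 1 := hχ1.self_of_nhds
    simp only [f, hχa, one_mul] at h0 ⊢
    rw [map_add, map_smul, hBlin, h0, hB1, zero_add, mul_one]
  rw [hline, deriv_id''] at h
  exact one_ne_zero h

end Subbundle

/-! ### The Cartan 2-form in terms of the Legendre transformation -/

namespace LieAlgebroid

variable (A : LieAlgebroid n F E)

theorem contMDiff_legendre_section {L : TotalSpace F E → ℝ}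
    (hL : ContMDiff ((𝓡 n).prod 𝓘(ℝ, F)) 𝓘(ℝ, ℝ) ∞ L) (σ : Cₛ^∞⟮𝓡 n; F, E⟯) :
    ContMDiff ((𝓡 n).prod 𝓘(ℝ, F)) 𝓘(ℝ, ℝ) ∞
      (fun c : TotalSpace F E => legendre (n := n) L c (σ c.proj)) :=
  contMDiff_legendre hL contMDiff_id (σ.contMDiff.comp (contMDiff_proj E))

/-- The value of `dθ_L` on `(σ(τ a), v)` and `(η(τ a), u)`, computed with the sections `σ`, `η`. -/
def cartanFormula (L : TotalSpace F E → ℝ) (a : TotalSpace F E)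
    (v u : TangentSpace ((𝓡 n).prod 𝓘(ℝ, F)) a) (σ η : Cₛ^∞⟮𝓡 n; F, E⟯) : ℝ :=
  dirDeriv ((𝓡 n).prod 𝓘(ℝ, F)) (fun c => legendre (n := n) L c (η c.proj)) a v -
    dirDeriv ((𝓡 n).prod 𝓘(ℝ, F)) (fun c => legendre (n := n) L c (σ c.proj)) a u -
    legendre (n := n) L a (A.bracket σ η a.proj)

/-- `S` forgets the vector field component, so `θ_L` of a projectable section is the Legendre
pairing with its base section, by definition. -/
theorem extDerivProjectable_cartanOneForm (L : TotalSpace F E → ℝ) (Z W : A.ProjectableSection)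
    (a : TotalSpace F E) : A.extDerivProjectable (A.cartanOneForm L) Z W a =
      A.cartanFormula L a (Z.field a) (W.field a) Z.base W.base :=
  rfl

theorem cartanFormula_self (L : TotalSpace F E → ℝ) (a : TotalSpace F E)
    (v : TangentSpace ((𝓡 n).prod 𝓘(ℝ, F)) a) (σ : Cₛ^∞⟮𝓡 n; F, E⟯) :
    A.cartanFormula L a v v σ σ = 0 := by
  have h : A.bracket σ σ a.proj = 0 := by rw [A.bracket_self]; rfl
  rw [cartanFormula, h, map_zero, sub_self, sub_zero]

-- The tangent vector and the section vary together, as the two components of one element of the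
-- prolongation; smoothness of `L` is needed to differentiate the sum of pairings.
variable {A} in
theorem cartanFormula_add_left {L : TotalSpace F E → ℝ}
    (hL : ContMDiff ((𝓡 n).prod 𝓘(ℝ, F)) 𝓘(ℝ, ℝ) ∞ L) (a : TotalSpace F E)
    (v v' u : TangentSpace ((𝓡 n).prod 𝓘(ℝ, F)) a) (σ σ' η : Cₛ^∞⟮𝓡 n; F, E⟯) :
    A.cartanFormula L a (v + v') u (σ + σ') η =
      A.cartanFormula L a v u σ η + A.cartanFormula L a v' u σ' η := by
  have h1 : (fun c : TotalSpace F E => legendre (n := n) L c ((σ + σ') c.proj)) =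
      fun c => legendre (n := n) L c (σ c.proj) + legendre (n := n) L c (σ' c.proj) :=
    funext fun c => map_add _ _ _
  have h2 : A.bracket (σ + σ') η a.proj = A.bracket σ η a.proj + A.bracket σ' η a.proj := by
    rw [map_add]; rfl
  unfold cartanFormula
  rw [h1, h2, dirDeriv_add ((contMDiff_legendre_section hL σ).mdifferentiableAt (by simp))
    ((contMDiff_legendre_section hL σ').mdifferentiableAt (by simp)), dirDeriv_map_add, map_add]
  ring

variable {A} in
theorem cartanFormula_smul_left {L : TotalSpace F E → ℝ}
    (hL : ContMDiff ((𝓡 n).prod 𝓘(ℝ, F)) 𝓘(ℝ, ℝ) ∞ L) (a : TotalSpace F E) (t : ℝ)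
    (v u : TangentSpace ((𝓡 n).prod 𝓘(ℝ, F)) a) (σ η : Cₛ^∞⟮𝓡 n; F, E⟯) :
    A.cartanFormula L a (t • v) u (t • σ) η = t * A.cartanFormula L a v u σ η := by
  have h1 : (fun c : TotalSpace F E => legendre (n := n) L c ((t • σ) c.proj)) =
      fun c => t * legendre (n := n) L c (σ c.proj) :=
    funext fun c => map_smul _ _ _
  have h2 : A.bracket (t • σ) η a.proj = t • A.bracket σ η a.proj := by
    rw [map_smul]; rfl
  unfold cartanFormula
  rw [h1, h2, dirDeriv_const_mul ((contMDiff_legendre_section hL σ).mdifferentiableAt (by simp)),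
    dirDeriv_map_smul, map_smul, smul_eq_mul]
  ring

theorem cartanFormula_swap (L : TotalSpace F E → ℝ) (a : TotalSpace F E)
    (v u : TangentSpace ((𝓡 n).prod 𝓘(ℝ, F)) a) (σ η : Cₛ^∞⟮𝓡 n; F, E⟯) :
    A.cartanFormula L a u v η σ = -A.cartanFormula L a v u σ η := by
  have h : A.bracket η σ = -A.bracket σ η := by
    have h := A.bracket_self (σ + η)
    simp only [map_add, LinearMap.add_apply, A.bracket_self, zero_add, add_zero] at h
    exact eq_neg_of_add_eq_zero_left h
  have h2 : A.bracket η σ a.proj = -(A.bracket σ η a.proj) := by rw [h]; rfl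
  unfold cartanFormula
  rw [h2, map_neg]
  ring

/-- If the formula for `dθ_L` does not depend on the sections used, then it computes `ω_L`. -/
theorem cartanTwoForm_apply {L : TotalSpace F E → ℝ}
    (hL : ContMDiff ((𝓡 n).prod 𝓘(ℝ, F)) 𝓘(ℝ, ℝ) ∞ L) {a : TotalSpace F E}
    (hind : ∀ (z w : A.Prolongation a) (σ σ' η η' : Cₛ^∞⟮𝓡 n; F, E⟯), σ a.proj = z.1.1 →
      σ' a.proj = z.1.1 → η a.proj = w.1.1 → η' a.proj = w.1.1 →
      A.cartanFormula L a z.1.2 w.1.2 σ η = A.cartanFormula L a z.1.2 w.1.2 σ' η')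
    (z w : A.Prolongation a) {σ η : Cₛ^∞⟮𝓡 n; F, E⟯} (hσ : σ a.proj = z.1.1)
    (hη : η a.proj = w.1.1) :
    A.cartanTwoForm L a z w = -A.cartanFormula L a z.1.2 w.1.2 σ η := by
  let ev : Cₛ^∞⟮𝓡 n; F, E⟯ →ₗ[ℝ] E a.proj :=
    { toFun := fun σ => σ a.proj, map_add' := fun _ _ => rfl, map_smul' := fun _ _ => rfl }
  have hev : Function.Surjective ev := fun b => exists_section_through (n := n) (F := F) b
  -- A linear choice of sections with given values makes the formula bilinear; `hind` then
  -- identifies its value with that for any other choice, so the defining property in `extDerivOne`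
  -- can be satisfied.
  obtain ⟨s, hs⟩ := ev.exists_rightInverse_of_surjective (LinearMap.range_eq_top.2 hev)
  have hs' : ∀ b, s b a.proj = b := fun b => congrArg (fun S => S b) hs
  have hex : ∃ B : LinearMap.BilinForm ℝ (A.Prolongation a), ∀ Z W : A.ProjectableSection,
      B (Z.eval a) (W.eval a) = A.extDerivProjectable (A.cartanOneForm L) Z W a := by
    refine ⟨LinearMap.mk₂ ℝ (fun z w => A.cartanFormula L a z.1.2 w.1.2 (s z.1.1) (s w.1.1))
      ?_ ?_ ?_ ?_, fun Z W => ?_⟩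
    · intro z z' w
      have h : s (z + z').1.1 = s z.1.1 + s z'.1.1 := map_add s _ _
      rw [h]
      exact cartanFormula_add_left hL a _ _ _ _ _ _
    · intro t z w
      have h : s (t • z).1.1 = t • s z.1.1 := map_smul s _ _
      rw [h]
      exact cartanFormula_smul_left hL a _ _ _ _ _
    -- Linearity in the second argument follows from the first by antisymmetry.
    · intro z w w'
      have h : s (w + w').1.1 = s w.1.1 + s w'.1.1 := map_add s _ _
      rw [h]
      have h1 := cartanFormula_add_left (A := A) hL a w.1.2 w'.1.2 z.1.2 (s w.1.1) (s w'.1.1)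
        (s z.1.1)
      have h2 := A.cartanFormula_swap L a (w + w').1.2 z.1.2 (s w.1.1 + s w'.1.1) (s z.1.1)
      rw [h2]
      refine (congrArg Neg.neg h1).trans ?_
      rw [A.cartanFormula_swap L a w.1.2 z.1.2, A.cartanFormula_swap L a w'.1.2 z.1.2]
      ring
    · intro t z w
      have h : s (t • w).1.1 = t • s w.1.1 := map_smul s _ _
      rw [h]
      have h1 := cartanFormula_smul_left (A := A) hL a t w.1.2 z.1.2 (s w.1.1) (s z.1.1)
      have h2 := A.cartanFormula_swap L a (t • w).1.2 z.1.2 (t • s w.1.1) (s z.1.1)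
      rw [h2]
      refine (congrArg Neg.neg h1).trans ?_
      rw [A.cartanFormula_swap L a w.1.2 z.1.2, smul_eq_mul]
      ring
    · exact (hind (Z.eval a) (W.eval a) (s (Z.base a.proj)) Z.base (s (W.base a.proj)) W.base
        (hs' _) rfl (hs' _) rfl).trans (A.extDerivProjectable_cartanOneForm L Z W a).symm
  obtain ⟨Z, rfl⟩ := A.exists_projectable z
  obtain ⟨W, rfl⟩ := A.exists_projectable w
  have h := Classical.epsilon_spec hex Z W
  exact congrArg Neg.neg (h.trans ((A.extDerivProjectable_cartanOneForm L Z W a).trans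
    (hind (Z.eval a) (W.eval a) Z.base σ W.base η rfl hσ rfl hη)))

/-- The derivative of the pairing of the Legendre transformation along a map `c` with a section
along `c`, in terms of a local frame. -/
theorem dirDeriv_legendre_along {L : TotalSpace F E → ℝ}
    (hL : ContMDiff ((𝓡 n).prod 𝓘(ℝ, F)) 𝓘(ℝ, ℝ) ∞ L)
    {H V N : Type*} [TopologicalSpace H] [NormedAddCommGroup V] [NormedSpace ℝ V]
    {I : ModelWithCorners ℝ V H} [TopologicalSpace N] [ChartedSpace H N] [IsManifold I ∞ N]
    {c : N → TotalSpace F E} {y : Π x, E (c x).proj} {x₀ : N}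
    {k : ℕ} {e : Fin k → Cₛ^∞⟮𝓡 n; F, E⟯} {ε : Fin k → Π x, E x →ₗ[ℝ] ℝ}
    (hε : ∀ i, ContMDiff ((𝓡 n).prod 𝓘(ℝ, F)) 𝓘(ℝ, ℝ) ∞
      (fun a : TotalSpace F E => ε i a.proj a.snd))
    (he : ∀ᶠ x in 𝓝 (c x₀).proj, ∀ b : E x, b = ∑ i, ε i x b • e i x)
    (hc : ContMDiff I ((𝓡 n).prod 𝓘(ℝ, F)) ∞ c)
    (hy : ContMDiff I ((𝓡 n).prod 𝓘(ℝ, F)) ∞ (fun x => (⟨(c x).proj, y x⟩ : TotalSpace F E)))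
    (v : TangentSpace I x₀) :
    dirDeriv I (fun x => legendre (n := n) L (c x) (y x)) x₀ v =
      dirDeriv I (fun x => ∑ i, legendre (n := n) L (c x₀) (e i (c x₀).proj) *
        ε i (c x).proj (y x)) x₀ v +
      ∑ i, ε i (c x₀).proj (y x₀) * dirDeriv ((𝓡 n).prod 𝓘(ℝ, F))
        (fun b => legendre (n := n) L b (e i b.proj)) (c x₀)
        (mfderiv I ((𝓡 n).prod 𝓘(ℝ, F)) c x₀ v) := by
  have hεd : ∀ i, MDifferentiableAt I 𝓘(ℝ, ℝ) (fun x => ε i (c x).proj (y x)) x₀ :=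
    fun i => ((hε i).comp hy).mdifferentiableAt (by simp)
  have hLe : ∀ i, MDifferentiableAt I 𝓘(ℝ, ℝ)
      (fun x => legendre (n := n) L (c x) (e i (c x).proj)) x₀ :=
    fun i => ((contMDiff_legendre_section hL (e i)).comp hc).mdifferentiableAt (by simp)
  have h1 : (fun x => legendre (n := n) L (c x) (y x)) =ᶠ[𝓝 x₀]
      fun x => ∑ i, ε i (c x).proj (y x) * legendre (n := n) L (c x) (e i (c x).proj) := by
    have hcont : ContinuousAt (fun x => (c x).proj) x₀ :=
      (((contMDiff_proj E (n := ∞) (IB := 𝓡 n)).comp hc).continuous).continuousAt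
    filter_upwards [hcont.eventually he] with x hx
    conv_lhs => rw [hx (y x)]
    simp only [map_sum, map_smul, smul_eq_mul]
  rw [dirDeriv_congr h1, dirDeriv_sum (f := fun i x => ε i (c x).proj (y x) *
      legendre (n := n) L (c x) (e i (c x).proj)) (fun i => (hεd i).mul (hLe i)),
    dirDeriv_sum (f := fun i x => legendre (n := n) L (c x₀) (e i (c x₀).proj) *
      ε i (c x).proj (y x)) (fun i => mdifferentiableAt_const.mul (hεd i)), ← Finset.sum_add_distrib]
  refine Finset.sum_congr rfl fun i _ => ?_
  rw [dirDeriv_mul (hεd i) (hLe i), dirDeriv_const_mul (hεd i),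
    ← dirDeriv_comp ((contMDiff_legendre_section hL (e i)).mdifferentiableAt (by simp))
      (hc.mdifferentiableAt (by simp))]
  ring

/-- The energy is smooth. -/
theorem contMDiff_energy {L : TotalSpace F E → ℝ}
    (hL : ContMDiff ((𝓡 n).prod 𝓘(ℝ, F)) 𝓘(ℝ, ℝ) ∞ L) :
    ContMDiff ((𝓡 n).prod 𝓘(ℝ, F)) 𝓘(ℝ, ℝ) ∞ (A.energy L) := by
  have h : ContMDiff ((𝓡 n).prod 𝓘(ℝ, F)) 𝓘(ℝ, ℝ) ∞
      (fun a : TotalSpace F E => legendre (n := n) L a a.snd) :=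
    contMDiff_legendre hL contMDiff_id contMDiff_id
  exact h.sub hL

/-- The differential of a 1-form on a pair of sections. -/
theorem extDeriv_one (θ : PForm E 1) (σ : Fin 2 → Cₛ^∞⟮𝓡 n; F, E⟯) (x : M) :
    A.extDeriv θ σ x =
      dirDeriv (𝓡 n) (fun y => θ y (fun _ => σ 1 y)) x (A.anchor x (σ 0 x)) -
      dirDeriv (𝓡 n) (fun y => θ y (fun _ => σ 0 y)) x (A.anchor x (σ 1 x)) -
      θ x (fun _ => A.bracket (σ 0) (σ 1) x) := by
  have h0 : ∀ y, (fun k : Fin 1 => (0 : Fin 2).removeNth σ k y) = fun _ => σ 1 y := by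
    intro y; funext k; fin_cases k; rfl
  have h1 : ∀ y, (fun k : Fin 1 => (1 : Fin 2).removeNth σ k y) = fun _ => σ 0 y := by
    intro y; funext k; fin_cases k; rfl
  have h2 : Matrix.vecCons (A.bracket (σ 0) (σ 1) x)
      (fun k => (0 : Fin 1).removeNth ((1 : Fin 2).removeNth σ) k x) =
      fun _ : Fin 1 => A.bracket (σ 0) (σ 1) x := by
    funext k; fin_cases k; rfl
  -- Two sections form a single pair `0 < 1`, whose sign is `-1`.
  have h3 : ∀ g : Fin 2 → Fin 1 → ℝ,
      (∑ j : Fin 2, ∑ i : Fin 1, if i.castSucc < j then g j i else 0) = g 1 0 := by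
    intro g
    rw [Fin.sum_univ_two, Fin.sum_univ_one, Fin.sum_univ_one]
    simp
  refine (congrArg₂ (· + ·) (Fin.sum_univ_two _)
    (h3 fun j i => (-1 : ℝ) ^ ((i : ℕ) + (j : ℕ)) *
      θ x (Matrix.vecCons (A.bracket (σ i.castSucc) (σ j) x)
        (fun k => i.removeNth (j.removeNth σ) k x)))).trans ?_
  change (-1 : ℝ) ^ 0 * dirDeriv (𝓡 n)
      (fun y => θ y (fun k : Fin 1 => (0 : Fin 2).removeNth σ k y)) x (A.anchor x (σ 0 x)) +
    (-1 : ℝ) ^ 1 * dirDeriv (𝓡 n)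
      (fun y => θ y (fun k : Fin 1 => (1 : Fin 2).removeNth σ k y)) x (A.anchor x (σ 1 x)) +
    ((-1 : ℝ) ^ (0 + 1) * θ x (Matrix.vecCons (A.bracket (σ 0) (σ 1) x)
      (fun k => (0 : Fin 1).removeNth ((1 : Fin 2).removeNth σ) k x))) = _
  simp only [h0, h1, h2]
  ring

end LieAlgebroid

end SingleBundle

section TwoBundles

variable {n n' : ℕ} {M M' : Type*}
  [TopologicalSpace M] [ChartedSpace (EuclideanSpace ℝ (Fin n)) M]
  [TopologicalSpace M'] [ChartedSpace (EuclideanSpace ℝ (Fin n')) M']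
  {F F' : Type*} [NormedAddCommGroup F] [NormedSpace ℝ F]
  [NormedAddCommGroup F'] [NormedSpace ℝ F']
  {E : M → Type*} [TopologicalSpace (TotalSpace F E)] [∀ x, TopologicalSpace (E x)]
  [FiberBundle F E] [∀ x, AddCommGroup (E x)] [∀ x, Module ℝ (E x)] [VectorBundle ℝ F E]
  {E' : M' → Type*} [TopologicalSpace (TotalSpace F' E')] [∀ x, TopologicalSpace (E' x)]
  [FiberBundle F' E'] [∀ x, AddCommGroup (E' x)] [∀ x, Module ℝ (E' x)] [VectorBundle ℝ F' E']
  [T2Space M] [IsManifold (𝓡 n) ∞ M] [FiniteDimensional ℝ F] [ContMDiffVectorBundle ∞ F E (𝓡 n)]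
  [T2Space M'] [IsManifold (𝓡 n') ∞ M'] [FiniteDimensional ℝ F']
  [ContMDiffVectorBundle ∞ F' E' (𝓡 n')]

/-! ### The prolongation of a morphism -/

namespace LieAlgebroidMorphism

open LieAlgebroid

variable {A : LieAlgebroid n F E} {A' : LieAlgebroid n' F' E'} (Φ : LieAlgebroidMorphism A A')

theorem contMDiff_toFun :
    ContMDiff ((𝓡 n).prod 𝓘(ℝ, F)) ((𝓡 n').prod 𝓘(ℝ, F')) ∞ Φ.toFun :=
  Φ.smooth

theorem mdifferentiableAt_toFun (a : TotalSpace F E) :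
    MDifferentiableAt ((𝓡 n).prod 𝓘(ℝ, F)) ((𝓡 n').prod 𝓘(ℝ, F')) Φ.toFun a :=
  Φ.contMDiff_toFun.mdifferentiableAt (by simp)

/-- A morphism intertwines the anchors. -/
theorem anchor_fiberMap (x : M) (b : E x) :
    A'.anchor (Φ.base x) (Φ.fiberMap x b) = mfderiv (𝓡 n) (𝓡 n') Φ.base x (A.anchor x b) := by
  refine tangent_ext fun f hf => ?_
  obtain ⟨σ, hσ⟩ := exists_section_through (n := n) (F := F) b
  obtain ⟨σ', hσ'⟩ := exists_section_through (n := n') (F := F') (Φ.fiberMap x b)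
  -- For 0-forms the morphism condition says exactly that the anchors are related, tested on
  -- functions.
  have h := Φ.pullback_extDeriv 0 (fun y => AlternatingMap.constOfIsEmpty ℝ (E' y) (Fin 0) (f y))
    (fun _ => hf) x (fun _ => σ) (fun _ => σ') (fun _ => by rw [hσ, hσ'])
  have h' : dirDeriv (𝓡 n') f (Φ.base x) (A'.anchor (Φ.base x) (σ' (Φ.base x))) =
    dirDeriv (𝓡 n) (fun y => f (Φ.base y)) x (A.anchor x (σ x)) := h
  rw [hσ, hσ'] at h'
  rw [h', dirDeriv_comp (hf.mdifferentiableAt (by simp))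
    (Φ.base_smooth.mdifferentiableAt (by simp))]

/-- The derivative of `τ' ∘ Φ = φ ∘ τ`. -/
theorem mfderiv_proj_mfderiv_toFun (a : TotalSpace F E)
    (v : TangentSpace ((𝓡 n).prod 𝓘(ℝ, F)) a) :
    mfderiv ((𝓡 n').prod 𝓘(ℝ, F')) (𝓡 n') (TotalSpace.proj : TotalSpace F' E' → M') (Φ.toFun a)
        (mfderiv ((𝓡 n).prod 𝓘(ℝ, F)) ((𝓡 n').prod 𝓘(ℝ, F')) Φ.toFun a v) =
      mfderiv (𝓡 n) (𝓡 n') Φ.base a.proj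
        (mfderiv ((𝓡 n).prod 𝓘(ℝ, F)) (𝓡 n) (TotalSpace.proj : TotalSpace F E → M) a v) := by
  have h1 := mfderiv_comp a (g := (TotalSpace.proj : TotalSpace F' E' → M')) (I'' := 𝓡 n')
    ((contMDiff_proj E' (n := ∞)).mdifferentiableAt (by simp)) (Φ.mdifferentiableAt_toFun a)
  have h2 := mfderiv_comp a (f := (TotalSpace.proj : TotalSpace F E → M)) (I := (𝓡 n).prod 𝓘(ℝ, F))
    (Φ.base_smooth.mdifferentiableAt (by simp))
    ((contMDiff_proj E (n := ∞) (IB := 𝓡 n)).mdifferentiableAt (by simp))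
  exact (congrArg (fun S => S v) h1).symm.trans (congrArg (fun S => S v) h2)

/-- The prolongation `𝒯Φ(b, v) = (Φ(b), TΦ(v))`. -/
def prolong (a : TotalSpace F E) : A.Prolongation a →ₗ[ℝ] A'.Prolongation (Φ.toFun a) where
  toFun z := ⟨(Φ.fiberMap a.proj z.1.1,
    mfderiv ((𝓡 n).prod 𝓘(ℝ, F)) ((𝓡 n').prod 𝓘(ℝ, F')) Φ.toFun a z.1.2), by
      refine (Φ.anchor_fiberMap a.proj z.1.1).trans ?_
      rw [Φ.mfderiv_proj_mfderiv_toFun, ← (z.2 : A.anchor a.proj z.1.1 = _)]⟩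
  map_add' z w := Subtype.ext (Prod.ext (map_add _ _ _) (map_add _ _ _))
  map_smul' t z := Subtype.ext (Prod.ext (map_smul _ _ _) (map_smul _ _ _))

/-- `Φ` is linear on fibres and maps the line `a + t b` to the line `Φ a + t Φ b`. -/
theorem mfderiv_toFun_vertical (a : TotalSpace F E) (b : E a.proj) :
    mfderiv ((𝓡 n).prod 𝓘(ℝ, F)) ((𝓡 n').prod 𝓘(ℝ, F')) Φ.toFun a (vertical a b) =
      vertical (Φ.toFun a) (Φ.fiberMap a.proj b) := by
  rw [← mfderiv_vertical b (Φ.mdifferentiableAt_toFun a)]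
  have h : (fun t : ℝ => Φ.toFun ⟨a.proj, a.snd + t • b⟩) = fun t : ℝ =>
      (⟨Φ.base a.proj, Φ.fiberMap a.proj a.snd + t • Φ.fiberMap a.proj b⟩ : TotalSpace F' E') := by
    funext t
    simp only [toFun, map_add, map_smul]
  rw [h]
  rfl

theorem prolong_verticalLift (a : TotalSpace F E) (b : E a.proj) :
    Φ.prolong a (A.verticalLift a b) = A'.verticalLift (Φ.toFun a) (Φ.fiberMap a.proj b) :=
  Subtype.ext (Prod.ext (map_zero _) (Φ.mfderiv_toFun_vertical a b))

theorem prolong_verticalEndomorphism {a : TotalSpace F E} (z : A.Prolongation a) :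
    Φ.prolong a (A.verticalEndomorphism z) = A'.verticalEndomorphism (Φ.prolong a z) :=
  Φ.prolong_verticalLift a z.1.1

theorem prolong_liouville (a : TotalSpace F E) :
    Φ.prolong a (A.liouville a) = A'.liouville (Φ.toFun a) :=
  Φ.prolong_verticalLift a a.snd

theorem diff_comp {f : TotalSpace F' E' → ℝ} {a : TotalSpace F E}
    (hf : MDifferentiableAt ((𝓡 n').prod 𝓘(ℝ, F')) 𝓘(ℝ, ℝ) f (Φ.toFun a))
    (z : A.Prolongation a) :
    A.diff (fun b => f (Φ.toFun b)) z = A'.diff f (Φ.prolong a z) :=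
  dirDeriv_comp hf (Φ.mdifferentiableAt_toFun a) z.1.2

theorem legendre_comp {L : TotalSpace F' E' → ℝ}
    (hL : ContMDiff ((𝓡 n').prod 𝓘(ℝ, F')) 𝓘(ℝ, ℝ) ∞ L) (a : TotalSpace F E) (b : E a.proj) :
    legendre (n := n) (fun c => L (Φ.toFun c)) a b =
      legendre (n := n') L (Φ.toFun a) (Φ.fiberMap a.proj b) := by
  refine (dirDeriv_comp (hL.mdifferentiableAt (by simp)) (Φ.mdifferentiableAt_toFun a)
    (vertical a b)).trans ?_
  rw [Φ.mfderiv_toFun_vertical]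
  rfl

theorem energy_comp {L : TotalSpace F' E' → ℝ}
    (hL : ContMDiff ((𝓡 n').prod 𝓘(ℝ, F')) 𝓘(ℝ, ℝ) ∞ L) :
    A.energy (fun c => L (Φ.toFun c)) = fun a => A'.energy L (Φ.toFun a) := by
  funext a
  rw [energy, energy, Φ.diff_comp (hL.mdifferentiableAt (by simp)), Φ.prolong_liouville]

/-- The prolongation of a fibrewise surjective morphism is fibrewise surjective. -/
theorem prolong_surjective (hΦ : ∀ x, Function.Surjective (Φ.fiberMap x)) (a : TotalSpace F E) :
    Function.Surjective (Φ.prolong a) := by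
  intro w
  obtain ⟨b, hb⟩ := hΦ a.proj w.1.1
  obtain ⟨v, hv⟩ := mfderiv_proj_surjective a (A.anchor a.proj b)
  let z : A.Prolongation a := ⟨(b, v), hv.symm⟩
  -- `v` was chosen only to lift the anchor of `b`. Its image and the second component of `w` both
  -- project to the anchor of the first component of `w`, so they differ by a vertical vector, which
  -- is corrected using surjectivity on the fibre.
  have hk : mfderiv ((𝓡 n').prod 𝓘(ℝ, F')) (𝓡 n') (TotalSpace.proj : TotalSpace F' E' → M')
      (Φ.toFun a) (w.1.2 - (Φ.prolong a z).1.2) = 0 := by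
    rw [map_sub, ← (w.2 : A'.anchor _ w.1.1 = _), ← ((Φ.prolong a z).2 : A'.anchor _ _ = _),
      ← hb]
    exact sub_self _
  obtain ⟨c', hc'⟩ := exists_eq_vertical hk
  obtain ⟨c, hc⟩ := hΦ a.proj c'
  refine ⟨z + A.verticalLift a c, Subtype.ext (Prod.ext ?_ ?_)⟩
  · rw [map_add, Φ.prolong_verticalLift]
    exact (add_zero _).trans hb
  · rw [map_add, Φ.prolong_verticalLift, hc]
    change (Φ.prolong a z).1.2 + vertical (Φ.toFun a) c' = w.1.2
    rw [← hc']
    exact add_sub_cancel _ _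

/-- The formula for the differential of the Cartan 1-form is natural. -/
theorem cartanFormula_comp {L : TotalSpace F' E' → ℝ}
    (hL : ContMDiff ((𝓡 n').prod 𝓘(ℝ, F')) 𝓘(ℝ, ℝ) ∞ L) {a : TotalSpace F E}
    (z w : A.Prolongation a) {σ η : Cₛ^∞⟮𝓡 n; F, E⟯} {σ' η' : Cₛ^∞⟮𝓡 n'; F', E'⟯}
    (hσ : σ a.proj = z.1.1) (hη : η a.proj = w.1.1)
    (hσ' : σ' (Φ.base a.proj) = Φ.fiberMap a.proj z.1.1)
    (hη' : η' (Φ.base a.proj) = Φ.fiberMap a.proj w.1.1) :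
    A.cartanFormula (fun c => L (Φ.toFun c)) a z.1.2 w.1.2 σ η =
      A'.cartanFormula L (Φ.toFun a) (Φ.prolong a z).1.2 (Φ.prolong a w).1.2 σ' η' := by
  obtain ⟨k, e, ε, hε, he⟩ := exists_local_frame (n := n') (F := F') (E := E') (Φ.base a.proj)
  let l : E' (Φ.base a.proj) →ₗ[ℝ] ℝ := legendre (n := n') L (Φ.toFun a)
  -- a one-form which agrees with the Legendre transform at the given point
  let θ : Π x, E' x →ₗ[ℝ] ℝ := fun x => ∑ i, l (e i (Φ.base a.proj)) • ε i x
  have hθ : ∀ x (b : E' x), θ x b = ∑ i, l (e i (Φ.base a.proj)) * ε i x b := by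
    intro x b
    simp [θ]
  have hθl : ∀ b, θ (Φ.base a.proj) b = l b := by
    intro b
    rw [hθ]
    conv_rhs => rw [he.self_of_nhds b]
    simp only [map_sum, map_smul, smul_eq_mul]
    exact Finset.sum_congr rfl fun i _ => mul_comm _ _
  have hθs : ContMDiff ((𝓡 n').prod 𝓘(ℝ, F')) 𝓘(ℝ, ℝ) ∞
      (fun b : TotalSpace F' E' => θ b.proj b.snd) := by
    have h : (fun b : TotalSpace F' E' => θ b.proj b.snd) =
        fun b => ∑ i, l (e i (Φ.base a.proj)) * ε i b.proj b.snd := funext fun b => hθ _ _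
    rw [h]
    exact contMDiff_finsetSum fun i _ => contMDiff_const.mul (hε i)
  -- differentiating the Legendre transform along a section
  have key : ∀ (τ : Cₛ^∞⟮𝓡 n; F, E⟯) (τ' : Cₛ^∞⟮𝓡 n'; F', E'⟯) (u : A.Prolongation a),
      τ' (Φ.base a.proj) = Φ.fiberMap a.proj (τ a.proj) →
      dirDeriv ((𝓡 n).prod 𝓘(ℝ, F))
          (fun c => legendre (n := n) (fun c => L (Φ.toFun c)) c (τ c.proj)) a u.1.2 -
        dirDeriv ((𝓡 n').prod 𝓘(ℝ, F')) (fun c => legendre (n := n') L c (τ' c.proj))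
          (Φ.toFun a) (Φ.prolong a u).1.2 =
      dirDeriv (𝓡 n) (fun x => θ (Φ.base x) (Φ.fiberMap x (τ x))) a.proj (A.anchor a.proj u.1.1) -
        dirDeriv (𝓡 n') (fun x => θ x (τ' x)) (Φ.base a.proj)
          (A'.anchor (Φ.base a.proj) (Φ.fiberMap a.proj u.1.1)) := by
    intro τ τ' u hτ
    have hsm : ContMDiff (𝓡 n) ((𝓡 n').prod 𝓘(ℝ, F')) ∞
        (fun x => (⟨Φ.base x, Φ.fiberMap x (τ x)⟩ : TotalSpace F' E')) :=
      Φ.smooth.comp τ.contMDiff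
    have h1 := dirDeriv_legendre_along hL (c := Φ.toFun) (x₀ := a)
      (y := fun b => Φ.fiberMap b.proj (τ b.proj)) hε he Φ.smooth
      (hsm.comp (contMDiff_proj E)) u.1.2
    have h2 := dirDeriv_legendre_along hL (c := id) (x₀ := Φ.toFun a)
      (y := fun b : TotalSpace F' E' => τ' b.proj) hε he contMDiff_id
      (τ'.contMDiff.comp (contMDiff_proj E')) (Φ.prolong a u).1.2
    have h3 : (fun c => legendre (n := n) (fun c => L (Φ.toFun c)) c (τ c.proj)) =
      fun c => legendre (n := n') L (Φ.toFun c) (Φ.fiberMap c.proj (τ c.proj)) :=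
      funext fun c => Φ.legendre_comp hL c _
    have g1 : MDifferentiableAt (𝓡 n) 𝓘(ℝ, ℝ) (fun x => θ (Φ.base x) (Φ.fiberMap x (τ x))) a.proj :=
      (hθs.comp hsm).mdifferentiableAt (by simp)
    have g2 : MDifferentiableAt (𝓡 n') 𝓘(ℝ, ℝ) (fun x => θ x (τ' x)) (Φ.base a.proj) :=
      (hθs.comp τ'.contMDiff).mdifferentiableAt (by simp)
    -- Unlike the Legendre pairing, the pairing of `θ` with a section comes from the base, so its
    -- derivative along an element of the prolongation is a derivative along the anchor.
    have d1 := dirDeriv_comp (c := (TotalSpace.proj : TotalSpace F E → M)) g1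
      ((contMDiff_proj E (n := ∞) (IB := 𝓡 n)).mdifferentiableAt (x := a) (by simp)) u.1.2
    have d2 := dirDeriv_comp (c := (TotalSpace.proj : TotalSpace F' E' → M')) (x := Φ.toFun a) g2
      ((contMDiff_proj E' (n := ∞) (IB := 𝓡 n')).mdifferentiableAt (x := Φ.toFun a) (by simp))
      (Φ.prolong a u).1.2
    rw [← (u.2 : A.anchor a.proj u.1.1 = _)] at d1
    rw [← ((Φ.prolong a u).2 : A'.anchor _ _ = _)] at d2
    have f1 : (fun b : TotalSpace F E => θ (Φ.base b.proj) (Φ.fiberMap b.proj (τ b.proj))) =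
      fun b => ∑ i, l (e i (Φ.base a.proj)) *
        ε i (Φ.base b.proj) (Φ.fiberMap b.proj (τ b.proj)) := funext fun b => hθ _ _
    have f2 : (fun b : TotalSpace F' E' => θ b.proj (τ' b.proj)) =
      fun b => ∑ i, l (e i (Φ.base a.proj)) * ε i b.proj (τ' b.proj) := funext fun b => hθ _ _
    rw [f1] at d1
    rw [f2] at d2
    have e1 := h1.trans (congrArg (· + _) d1)
    have e2 := h2.trans (congrArg (· + _) d2)
    rw [h3]
    -- The remainders see the sections only at the point, where `τ'` and `Φ ∘ τ` agree; hence they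
    -- cancel.
    have hr : ∑ i, ε i (Φ.base a.proj) (τ' (Φ.base a.proj)) *
        dirDeriv ((𝓡 n').prod 𝓘(ℝ, F')) (fun b => legendre (n := n') L b (e i b.proj)) (Φ.toFun a)
          (mfderiv ((𝓡 n').prod 𝓘(ℝ, F')) ((𝓡 n').prod 𝓘(ℝ, F')) id (Φ.toFun a)
            (Φ.prolong a u).1.2) =
      ∑ i, ε i (Φ.base a.proj) (Φ.fiberMap a.proj (τ a.proj)) *
        dirDeriv ((𝓡 n').prod 𝓘(ℝ, F')) (fun b => legendre (n := n') L b (e i b.proj)) (Φ.toFun a)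
          (mfderiv ((𝓡 n).prod 𝓘(ℝ, F)) ((𝓡 n').prod 𝓘(ℝ, F')) Φ.toFun a u.1.2) := by
      rw [hτ, mfderiv_id]
      rfl
    refine (congrArg₂ (· - ·) e1 (e2.trans (congrArg (_ + ·) hr))).trans ?_
    exact add_sub_add_right_eq_sub _ _ _
  have hform := Φ.pullback_extDeriv 1
    (fun x => AlternatingMap.ofSubsingleton ℝ (E' x) ℝ (0 : Fin 1) (θ x))
    (fun s => hθs.comp (s 0).contMDiff) a.proj ![σ, η] ![σ', η']
    (by
      intro i
      fin_cases i
      · exact hσ'.trans (congrArg _ hσ.symm)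
      · exact hη'.trans (congrArg _ hη.symm))
  have hform' : dirDeriv (𝓡 n') (fun x => θ x (η' x)) (Φ.base a.proj)
        (A'.anchor (Φ.base a.proj) (σ' (Φ.base a.proj))) -
      dirDeriv (𝓡 n') (fun x => θ x (σ' x)) (Φ.base a.proj)
        (A'.anchor (Φ.base a.proj) (η' (Φ.base a.proj))) -
      θ (Φ.base a.proj) (A'.bracket σ' η' (Φ.base a.proj)) =
    dirDeriv (𝓡 n) (fun x => θ (Φ.base x) (Φ.fiberMap x (η x))) a.proj
        (A.anchor a.proj (σ a.proj)) -
      dirDeriv (𝓡 n) (fun x => θ (Φ.base x) (Φ.fiberMap x (σ x))) a.proj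
        (A.anchor a.proj (η a.proj)) -
      θ (Φ.base a.proj) (Φ.fiberMap a.proj (A.bracket σ η a.proj)) :=
    ((A'.extDeriv_one _ _ _).symm.trans hform).trans (A.extDeriv_one _ _ _)
  rw [hθl, hθl, hσ, hη, hσ', hη'] at hform'
  -- In the bracket terms `θ` is already the Legendre transform at `Φ(a)`; only the two derivative
  -- terms have to be compared.
  have k1 := key η η' z (by rw [hη', hη])
  have k2 := key σ σ' w (by rw [hσ', hσ])
  unfold cartanFormula
  rw [Φ.legendre_comp hL]
  change _ - _ - l _ = _ - _ - l (A'.bracket σ' η' (Φ.base a.proj))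
  linear_combination k1 - k2 - hform'

end LieAlgebroidMorphism

/-! ### Invariance of nonholonomic mechanics under fibrewise surjective morphisms -/

/-! ### Complements and projections under a linear isomorphism. -/

section LinearAlgebra

variable {V W : Type*} [AddCommGroup V] [Module ℝ V] [AddCommGroup W] [Module ℝ W]

theorem isCompl_iff_of_linearEquiv (e : V ≃ₗ[ℝ] W) {p q : Submodule ℝ V} {p' q' : Submodule ℝ W}
    (hp : ∀ x, e x ∈ p' ↔ x ∈ p) (hq : ∀ x, e x ∈ q' ↔ x ∈ q) : IsCompl p q ↔ IsCompl p' q' := by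
  have hp' : Submodule.orderIsoMapComap e p = p' := by
    ext y
    obtain ⟨x, rfl⟩ := e.surjective y
    exact (Function.Injective.mem_set_image e.injective).trans (hp x).symm
  have hq' : Submodule.orderIsoMapComap e q = q' := by
    ext y
    obtain ⟨x, rfl⟩ := e.surjective y
    exact (Function.Injective.mem_set_image e.injective).trans (hq x).symm
  rw [← hp', ← hq']
  exact (Submodule.orderIsoMapComap e).isCompl_iff

/-- In the decomposition of `x`, the part in `q` goes to `q'` and is killed, while the part in `p`
goes to `p'` and is fixed. -/
theorem projection_linearEquiv (e : V ≃ₗ[ℝ] W) {p q : Submodule ℝ V} {p' q' : Submodule ℝ W}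
    (hp : ∀ x, e x ∈ p' ↔ x ∈ p) (hq : ∀ x, e x ∈ q' ↔ x ∈ q) (h : IsCompl p q)
    (h' : IsCompl p' q') (x : V) :
    Submodule.projection p' q' h' (e x) = e (Submodule.projection p q h x) := by
  have h1 : x - Submodule.projection p q h x ∈ q := by
    rw [← Submodule.projection_apply_eq_zero_iff h, map_sub,
      Submodule.projection_apply_of_mem_left h (Submodule.projection_apply_mem h x), sub_self]
  have h2 := (Submodule.projection_apply_eq_zero_iff h').2 ((hq _).2 h1)
  rw [map_sub, map_sub, sub_eq_zero] at h2
  rw [h2, Submodule.projection_apply_of_mem_left h' ((hp _).2 (Submodule.projection_apply_mem h x))]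

end LinearAlgebra

namespace LieAlgebroid

/-- Finite dimension lets a nondegenerate form represent every covector, which gives the existence
of Hamiltonian sections. -/
theorem finiteDimensional_prolongation (A : LieAlgebroid n F E) (a : TotalSpace F E) :
    FiniteDimensional ℝ (A.Prolongation a) := by
  have h1 : FiniteDimensional ℝ (E a.proj) :=
    ((trivializationAt F E a.proj).linearEquivAt ℝ a.proj
      (mem_baseSet_trivializationAt F E a.proj)).symm.finiteDimensional
  have h2 : FiniteDimensional ℝ (TangentSpace ((𝓡 n).prod 𝓘(ℝ, F)) a) :=
    inferInstanceAs (FiniteDimensional ℝ (EuclideanSpace ℝ (Fin n) × F))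
  infer_instance

/-- The Hamiltonian section exists where `ω_L` is nondegenerate. -/
theorem cartanTwoForm_hamiltonian (A : LieAlgebroid n F E) (L f : TotalSpace F E → ℝ)
    {a : TotalSpace F E} (h : (A.cartanTwoForm L a).Nondegenerate) (w : A.Prolongation a) :
    A.cartanTwoForm L a (A.hamiltonian L f a) w = A.diff f w := by
  have := A.finiteDimensional_prolongation a
  let df : Module.Dual ℝ (A.Prolongation a) :=
    { toFun := fun w => A.diff f w
      map_add' := fun w w' => dirDeriv_map_add f w.1.2 w'.1.2
      map_smul' := fun t w => dirDeriv_map_smul f t w.1.2 }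
  exact Classical.epsilon_spec (p := fun x => ∀ w, A.cartanTwoForm L a x w = A.diff f w)
    ⟨((A.cartanTwoForm L a).toDual h).symm df,
      fun w => LinearMap.BilinForm.apply_toDual_symm_apply (hB := h) df w⟩ w

/-- This also holds for the default value 0 of the projector, so complementarity need not be known.
-/
theorem projector_eq_zero (A : LieAlgebroid n F E) {L : TotalSpace F E → ℝ}
    {D : Subbundle n F E} {a : TotalSpace F E} {z : A.Prolongation a}
    (hz : z ∈ (A.cartanTwoForm L a).orthogonal (A.prolongationConstraint D a)) :
    A.projector L D a z = 0 := by
  unfold projector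
  split_ifs with hc
  · exact (Submodule.projection_apply_eq_zero_iff hc).2 hz
  · rfl

end LieAlgebroid

namespace LieAlgebroidMorphism

open LieAlgebroid

variable {A : LieAlgebroid n F E} {A' : LieAlgebroid n' F' E'} (Φ : LieAlgebroidMorphism A A')

/-! ### Naturality of the Cartan 2-form. -/

section CartanForm

variable {L : TotalSpace F' E' → ℝ}

/-- Sections of `E'` can be held fixed while those of `E` vary: `cartanFormula_comp` equates the
formula for every choice in `E` with one value in `E'`, so it is independent of the choice. -/
theorem cartanTwoForm_apply_left
    (hL : ContMDiff ((𝓡 n').prod 𝓘(ℝ, F')) 𝓘(ℝ, ℝ) ∞ L)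
    {a : TotalSpace F E} (z w : A.Prolongation a)
    {σ η : Cₛ^∞⟮𝓡 n; F, E⟯} (hσ : σ a.proj = z.1.1) (hη : η a.proj = w.1.1) :
    A.cartanTwoForm (fun c => L (Φ.toFun c)) a z w =
      -A.cartanFormula (fun c => L (Φ.toFun c)) a z.1.2 w.1.2 σ η := by
  refine A.cartanTwoForm_apply (hL.comp Φ.smooth) ?_ z w hσ hη
  intro z w σ₁ σ₂ η₁ η₂ h1 h2 h3 h4
  obtain ⟨σ', hσ'⟩ := exists_section_through (n := n') (F := F') (Φ.fiberMap a.proj z.1.1)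
  obtain ⟨η', hη'⟩ := exists_section_through (n := n') (F := F') (Φ.fiberMap a.proj w.1.1)
  exact (Φ.cartanFormula_comp hL z w h1 h3 hσ' hη').trans
    (Φ.cartanFormula_comp hL z w h2 h4 hσ' hη').symm

/-- The Cartan 2-form is natural. -/
theorem cartanTwoForm_comp
    (hL : ContMDiff ((𝓡 n').prod 𝓘(ℝ, F')) 𝓘(ℝ, ℝ) ∞ L)
    (hΦ : ∀ x, Function.Surjective (Φ.fiberMap x))
    {a : TotalSpace F E} (z w : A.Prolongation a) :
    A.cartanTwoForm (fun c => L (Φ.toFun c)) a z w =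
      A'.cartanTwoForm L (Φ.toFun a) (Φ.prolong a z) (Φ.prolong a w) := by
  obtain ⟨σ, hσ⟩ := exists_section_through (n := n) (F := F) z.1.1
  obtain ⟨η, hη⟩ := exists_section_through (n := n) (F := F) w.1.1
  obtain ⟨σ', hσ'⟩ := exists_section_through (n := n') (F := F') (Φ.fiberMap a.proj z.1.1)
  obtain ⟨η', hη'⟩ := exists_section_through (n := n') (F := F') (Φ.fiberMap a.proj w.1.1)
  rw [Φ.cartanTwoForm_apply_left hL z w hσ hη, Φ.cartanFormula_comp hL z w hσ hη hσ' hη']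
  refine (A'.cartanTwoForm_apply hL ?_ (Φ.prolong a z) (Φ.prolong a w) hσ' hη').symm
  intro z' w' σ₁ σ₂ η₁ η₂ h1 h2 h3 h4
  -- Independence of the sections of `E'` comes from comparison with `E`, which reaches only the
  -- image of the prolongation; surjectivity makes this everything.
  obtain ⟨z, rfl⟩ := Φ.prolong_surjective hΦ a z'
  obtain ⟨w, rfl⟩ := Φ.prolong_surjective hΦ a w'
  obtain ⟨σ, hσ⟩ := exists_section_through (n := n) (F := F) z.1.1
  obtain ⟨η, hη⟩ := exists_section_through (n := n) (F := F) w.1.1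
  exact (Φ.cartanFormula_comp hL z w hσ hη h1 h3).symm.trans
    (Φ.cartanFormula_comp hL z w hσ hη h2 h4)

theorem cartanTwoForm_isAlt
    (hL : ContMDiff ((𝓡 n').prod 𝓘(ℝ, F')) 𝓘(ℝ, ℝ) ∞ L)
    (a : TotalSpace F E) :
    (A.cartanTwoForm (fun c => L (Φ.toFun c)) a).IsAlt := by
  intro z
  obtain ⟨σ, hσ⟩ := exists_section_through (n := n) (F := F) z.1.1
  rw [Φ.cartanTwoForm_apply_left hL z z hσ hσ, cartanFormula_self, neg_zero]

/-- `ω_L` is a pullback, so a vector killed by the prolongation pairs to zero with every vector. -/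
theorem prolong_injective
    (hL : ContMDiff ((𝓡 n').prod 𝓘(ℝ, F')) 𝓘(ℝ, ℝ) ∞ L)
    (hΦ : ∀ x, Function.Surjective (Φ.fiberMap x))
    {a : TotalSpace F E}
    (h : (A.cartanTwoForm (fun c => L (Φ.toFun c)) a).Nondegenerate) :
    Function.Injective (Φ.prolong a) := by
  refine (injective_iff_map_eq_zero _).2 fun z hz => h.1 z fun w => ?_
  rw [Φ.cartanTwoForm_comp hL hΦ, hz, map_zero, LinearMap.zero_apply]

end CartanForm

/-- Vertical lifts embed the fibre in the prolongation, compatibly with `Φ`. -/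
theorem fiberMap_injective {a : TotalSpace F E} (h : Function.Injective (Φ.prolong a)) :
    Function.Injective (Φ.fiberMap a.proj) := by
  refine (injective_iff_map_eq_zero _).2 fun b hb => ?_
  have h1 : A.verticalLift a b = A.verticalLift a 0 := by
    refine h ?_
    rw [Φ.prolong_verticalLift, Φ.prolong_verticalLift, hb, map_zero]
  exact vertical_injective a (congrArg (fun z => z.1.2) h1)

/-! ### Transport of the constraint spaces. -/

section Constraint

variable {D : Subbundle n F E} {D' : Subbundle n' F' E'}

theorem mem_fiber_iff
    (hD : ∀ x, (D.fiber x).map (Φ.fiberMap x) = D'.fiber (Φ.base x))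
    {a : TotalSpace F E} (h : Function.Injective (Φ.prolong a))
    {b : E a.proj} : Φ.fiberMap a.proj b ∈ D'.fiber (Φ.base a.proj) ↔ b ∈ D.fiber a.proj := by
  rw [← hD]
  exact Function.Injective.mem_set_image (Φ.fiberMap_injective h)

/-- Functions vanishing on `D'` pull back to functions vanishing on `D`. -/
theorem mfderiv_toFun_mem_tangent
    (hD : ∀ x, (D.fiber x).map (Φ.fiberMap x) = D'.fiber (Φ.base x))
    {a : TotalSpace F E}
    {v : TangentSpace ((𝓡 n).prod 𝓘(ℝ, F)) a} (hv : v ∈ D.tangent a) :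
    mfderiv ((𝓡 n).prod 𝓘(ℝ, F)) ((𝓡 n').prod 𝓘(ℝ, F')) Φ.toFun a v ∈
      D'.tangent (Φ.toFun a) := by
  intro f hf h0
  rw [← dirDeriv_comp (hf.mdifferentiableAt (by simp)) (Φ.mdifferentiableAt_toFun a)]
  exact hv _ (hf.comp Φ.smooth) fun d hd => h0 _ (Φ.mem_carrier hD d hd)

/-- Where it is injective, the prolongation identifies the constraint spaces. -/
theorem prolong_mem_prolongationConstraint_iff
    (hD : ∀ x, (D.fiber x).map (Φ.fiberMap x) = D'.fiber (Φ.base x))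
    {a : TotalSpace F E} (ha : a ∈ D.carrier)
    (h : Function.Injective (Φ.prolong a)) (z : A.Prolongation a) :
    Φ.prolong a z ∈ A'.prolongationConstraint D' (Φ.toFun a) ↔
      z ∈ A.prolongationConstraint D a := by
  constructor
  · rintro ⟨h1, h2⟩
    have hb : z.1.1 ∈ D.fiber a.proj := (Φ.mem_fiber_iff hD h).1 h1
    refine ⟨hb, ?_⟩
    -- Subtracting a tangent lift of the same base vector leaves a vertical vector. For vertical
    -- vectors tangency is membership in the constraint fibre, which `Φ` reflects.
    obtain ⟨v, hv, hvz⟩ := Subbundle.exists_tangent_lift ha (A.anchor a.proj z.1.1)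
    have hk : mfderiv ((𝓡 n).prod 𝓘(ℝ, F)) (𝓡 n) (TotalSpace.proj : TotalSpace F E → M) a
        (z.1.2 - v) = 0 := by
      rw [map_sub, hvz, ← (z.2 : A.anchor a.proj z.1.1 = _), sub_self]
    obtain ⟨c, hc⟩ := exists_eq_vertical hk
    have h3 : vertical (Φ.toFun a) (Φ.fiberMap a.proj c) ∈ D'.tangent (Φ.toFun a) := by
      rw [← Φ.mfderiv_toFun_vertical, ← hc, map_sub]
      exact Submodule.sub_mem _ h2 (Φ.mfderiv_toFun_mem_tangent hD hv)
    have h4 := Subbundle.mem_of_vertical_mem_tangent (Φ.mem_carrier hD a ha) h3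
    have h5 := Subbundle.vertical_mem_tangent ha ((Φ.mem_fiber_iff hD h).1 h4)
    have h6 : z.1.2 = vertical a c + v := by rw [← hc, sub_add_cancel]
    change z.1.2 ∈ D.tangent a
    rw [h6]
    exact Submodule.add_mem _ h5 hv
  · rintro ⟨h1, h2⟩
    exact ⟨(Φ.mem_fiber_iff hD h).2 h1, Φ.mfderiv_toFun_mem_tangent hD h2⟩

theorem exists_mem_carrier
    (hD : ∀ x, (D.fiber x).map (Φ.fiberMap x) = D'.fiber (Φ.base x))
    (hbase : Function.Surjective Φ.base) {a' : TotalSpace F' E'}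
    (ha' : a' ∈ D'.carrier) : ∃ a ∈ D.carrier, Φ.toFun a = a' := by
  obtain ⟨x', b'⟩ := a'
  obtain ⟨x, rfl⟩ := hbase x'
  have h : b' ∈ (D.fiber x).map (Φ.fiberMap x) := by rw [hD]; exact ha'
  obtain ⟨b, hb, rfl⟩ := h
  exact ⟨⟨x, b⟩, hb, rfl⟩

end Constraint

/-! ### Transport of the equations of motion, the projector and the Hamiltonian sections. -/

section Dynamics

variable {D : Subbundle n F E} {D' : Subbundle n' F' E'}
  {L : TotalSpace F' E' → ℝ}

/-- The Lagrange-d'Alembert equations are natural. -/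
theorem isLagrangeDAlembert_prolong_iff
    (hL : ContMDiff ((𝓡 n').prod 𝓘(ℝ, F')) 𝓘(ℝ, ℝ) ∞ L)
    (hΦ : ∀ x, Function.Surjective (Φ.fiberMap x))
    (hD : ∀ x, (D.fiber x).map (Φ.fiberMap x) = D'.fiber (Φ.base x))
    {a : TotalSpace F E} (ha : a ∈ D.carrier)
    (h : Function.Injective (Φ.prolong a)) (z : A.Prolongation a) :
    A'.IsLagrangeDAlembert L D' (Φ.toFun a) (Φ.prolong a z) ↔
      A.IsLagrangeDAlembert (fun c => L (Φ.toFun c)) D a z := by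
  have hen : ∀ u : A.Prolongation a, A'.diff (A'.energy L) (Φ.prolong a u) =
      A.diff (A.energy (fun c => L (Φ.toFun c))) u := by
    intro u
    rw [Φ.energy_comp hL,
      Φ.diff_comp ((A'.contMDiff_energy hL).mdifferentiableAt (by simp))]
  refine and_congr (Φ.prolong_mem_prolongationConstraint_iff hD ha h z) (and_congr ?_ ?_)
  · rw [← Φ.prolong_verticalEndomorphism, ← Φ.prolong_liouville, h.eq_iff]
  constructor
  · rintro ⟨μ, hμ, hz⟩
    refine ⟨μ ∘ₗ Φ.fiberMap a.proj, ?_, fun u => ?_⟩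
    · rw [Submodule.mem_dualAnnihilator] at hμ ⊢
      exact fun b hb => hμ _ ((Φ.mem_fiber_iff hD h).2 hb)
    · rw [Φ.cartanTwoForm_comp hL hΦ, ← hen]
      exact hz (Φ.prolong a u)
  · rintro ⟨μ, hμ, hz⟩
    -- A multiplier on `E` moves to `E'` through the inverse of the fibre map, which is bijective at
    -- this point.
    let e : E a.proj ≃ₗ[ℝ] E' (Φ.base a.proj) :=
      LinearEquiv.ofBijective (Φ.fiberMap a.proj) ⟨Φ.fiberMap_injective h, hΦ a.proj⟩
    refine ⟨μ ∘ₗ e.symm.toLinearMap, ?_, fun u' => ?_⟩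
    · rw [Submodule.mem_dualAnnihilator] at hμ ⊢
      intro b' hb'
      obtain ⟨b, rfl⟩ := hΦ a.proj b'
      have h1 : e.symm (Φ.fiberMap a.proj b) = b := e.symm_apply_apply b
      change μ (e.symm (Φ.fiberMap a.proj b)) = 0
      rw [h1]
      exact hμ b ((Φ.mem_fiber_iff hD h).1 hb')
    · obtain ⟨u, rfl⟩ := Φ.prolong_surjective hΦ a u'
      rw [← Φ.cartanTwoForm_comp hL hΦ, hen, hz u]
      exact congrArg μ (e.symm_apply_apply u.1.1).symm

/-- The image of a regular constrained system is regular. -/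
theorem isRegular_of_comp
    (hL : ContMDiff ((𝓡 n').prod 𝓘(ℝ, F')) 𝓘(ℝ, ℝ) ∞ L)
    (hΦ : ∀ x, Function.Surjective (Φ.fiberMap x))
    (hD : ∀ x, (D.fiber x).map (Φ.fiberMap x) = D'.fiber (Φ.base x))
    (hreg : A.IsRegular (fun c => L (Φ.toFun c)) D)
    (hbase : Function.Surjective Φ.base) : A'.IsRegular L D' := by
  constructor
  · intro a' ha'
    obtain ⟨a, ha, rfl⟩ := Φ.exists_mem_carrier hD hbase ha'
    have hnd := hreg.nondegenerate a ha
    constructor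
    · intro z' hz'
      obtain ⟨z, rfl⟩ := Φ.prolong_surjective hΦ a z'
      rw [hnd.1 z fun w => by rw [Φ.cartanTwoForm_comp hL hΦ, hz'], map_zero]
    · intro z' hz'
      obtain ⟨z, rfl⟩ := Φ.prolong_surjective hΦ a z'
      rw [hnd.2 z fun w => by rw [Φ.cartanTwoForm_comp hL hΦ, hz'], map_zero]
  · intro a' ha'
    obtain ⟨a, ha, rfl⟩ := Φ.exists_mem_carrier hD hbase ha'
    have hinj := Φ.prolong_injective hL hΦ (hreg.nondegenerate a ha)
    obtain ⟨z, hz, hu⟩ := hreg.existsUnique a ha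
    refine ⟨Φ.prolong a z, (Φ.isLagrangeDAlembert_prolong_iff hL hΦ hD ha hinj z).2 hz,
      fun w' hw' => ?_⟩
    obtain ⟨w, rfl⟩ := Φ.prolong_surjective hΦ a w'
    rw [hu w ((Φ.isLagrangeDAlembert_prolong_iff hL hΦ hD ha hinj w).1 hw')]

/-- The prolongation is onto and preserves the forms, so testing against `C'` amounts to testing
against `C`. -/
theorem prolong_mem_orthogonal_iff
    (hL : ContMDiff ((𝓡 n').prod 𝓘(ℝ, F')) 𝓘(ℝ, ℝ) ∞ L)
    (hΦ : ∀ x, Function.Surjective (Φ.fiberMap x))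
    {a : TotalSpace F E} {C : Submodule ℝ (A.Prolongation a)}
    {C' : Submodule ℝ (A'.Prolongation (Φ.toFun a))} (hC : ∀ z, Φ.prolong a z ∈ C' ↔ z ∈ C)
    (z : A.Prolongation a) :
    Φ.prolong a z ∈ (A'.cartanTwoForm L (Φ.toFun a)).orthogonal C' ↔
      z ∈ (A.cartanTwoForm (fun c => L (Φ.toFun c)) a).orthogonal C := by
  simp only [LinearMap.BilinForm.mem_orthogonal_iff]
  constructor
  · intro h w hw
    rw [Φ.cartanTwoForm_comp hL hΦ]
    exact h _ ((hC w).2 hw)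
  · intro h w' hw'
    obtain ⟨w, rfl⟩ := Φ.prolong_surjective hΦ a w'
    rw [← Φ.cartanTwoForm_comp hL hΦ]
    exact h w ((hC w).1 hw')

theorem projector_prolong
    (hL : ContMDiff ((𝓡 n').prod 𝓘(ℝ, F')) 𝓘(ℝ, ℝ) ∞ L)
    (hΦ : ∀ x, Function.Surjective (Φ.fiberMap x))
    (hD : ∀ x, (D.fiber x).map (Φ.fiberMap x) = D'.fiber (Φ.base x))
    {a : TotalSpace F E} (ha : a ∈ D.carrier)
    (h : Function.Injective (Φ.prolong a)) (z : A.Prolongation a) :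
    A'.projector L D' (Φ.toFun a) (Φ.prolong a z) =
      Φ.prolong a (A.projector (fun c => L (Φ.toFun c)) D a z) := by
  let e := LinearEquiv.ofBijective (Φ.prolong a) ⟨h, Φ.prolong_surjective hΦ a⟩
  have hp := Φ.prolong_mem_prolongationConstraint_iff hD ha h
  have hq := Φ.prolong_mem_orthogonal_iff hL hΦ hp
  have hiff := isCompl_iff_of_linearEquiv e hp hq
  unfold projector
  by_cases hc : IsCompl (A.prolongationConstraint D a)
      ((A.cartanTwoForm (fun c => L (Φ.toFun c)) a).orthogonal (A.prolongationConstraint D a))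
  · rw [dif_pos hc, dif_pos (hiff.1 hc)]
    exact projection_linearEquiv e hp hq hc (hiff.1 hc) z
  -- Complementarity holds on both sides or on neither; in the latter case both projectors take the
  -- default value 0.
  · rw [dif_neg hc, dif_neg (hc ∘ hiff.2)]
    exact (map_zero _).symm

/-- The constrained Hamiltonian sections are related by the prolongation. -/
theorem projector_hamiltonian_pullback
    (hL : ContMDiff ((𝓡 n').prod 𝓘(ℝ, F')) 𝓘(ℝ, ℝ) ∞ L)
    (hΦ : ∀ x, Function.Surjective (Φ.fiberMap x))
    (hD : ∀ x, (D.fiber x).map (Φ.fiberMap x) = D'.fiber (Φ.base x))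
    (hreg : A.IsRegular (fun c => L (Φ.toFun c)) D)
    (hreg' : A'.IsRegular L D') (f : D'.SmoothFunction) (a : D.carrier) :
    A'.projector L D' (Φ.toFun a)
        (A'.hamiltonian L (f.extension (Φ.restrict (Φ.mem_carrier hD) a)) (Φ.toFun a)) =
      Φ.prolong a (A.projector (fun c => L (Φ.toFun c)) D a
        (A.hamiltonian (fun c => L (Φ.toFun c))
          ((Φ.pullback (Φ.mem_carrier hD) f).extension a) a)) := by
  set a' := Φ.restrict (Φ.mem_carrier hD) a
  set g := (Φ.pullback (Φ.mem_carrier hD) f).extension a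
  set g' := f.extension a'
  have hgs : ContMDiff ((𝓡 n).prod 𝓘(ℝ, F)) 𝓘(ℝ, ℝ) ∞ g :=
    ((Φ.pullback (Φ.mem_carrier hD) f).exists_extension a).choose_spec.1
  have hge : ∀ᶠ b : D.carrier in 𝓝 a,
      (Φ.pullback (Φ.mem_carrier hD) f).toFun b = g b :=
    ((Φ.pullback (Φ.mem_carrier hD) f).exists_extension a).choose_spec.2
  have hgs' : ContMDiff ((𝓡 n').prod 𝓘(ℝ, F')) 𝓘(ℝ, ℝ) ∞ g' :=
    (f.exists_extension a').choose_spec.1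
  have hge' : ∀ᶠ b : D'.carrier in 𝓝 a', f.toFun b = g' b :=
    (f.exists_extension a').choose_spec.2
  have hnd := hreg.nondegenerate a a.2
  have hnd' := hreg'.nondegenerate (Φ.toFun a) a'.2
  have hinj := Φ.prolong_injective hL hΦ hnd
  rw [← Φ.projector_prolong hL hΦ hD a.2 hinj, ← sub_eq_zero, ← map_sub]
  refine A'.projector_eq_zero ?_
  -- By naturality `x` represents `d(g' ∘ Φ)`, so what remains is to compare two extensions of one
  -- function on `D`.
  obtain ⟨x, hx⟩ := Φ.prolong_surjective hΦ a (A'.hamiltonian L g' (Φ.toFun a))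
  rw [← hx, ← map_sub, Φ.prolong_mem_orthogonal_iff hL hΦ
    (Φ.prolong_mem_prolongationConstraint_iff hD a.2 hinj)]
  intro w hw
  change A.cartanTwoForm (fun c => L (Φ.toFun c)) a w _ = 0
  have halt := Φ.cartanTwoForm_isAlt hL (a : TotalSpace F E)
  -- Orthogonality puts `w` in the left slot, while Hamiltonian sections are defined through the
  -- left slot; alternation exchanges the two.
  rw [← halt.neg_eq, map_sub, LinearMap.sub_apply,
    A.cartanTwoForm_hamiltonian _ _ hnd, Φ.cartanTwoForm_comp hL hΦ, hx,
    A'.cartanTwoForm_hamiltonian _ _ hnd', ← Φ.diff_comp (hgs'.mdifferentiableAt (by simp)),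
    neg_eq_zero]
  have hcs : ContMDiff ((𝓡 n).prod 𝓘(ℝ, F)) 𝓘(ℝ, ℝ) ∞ (fun b => g' (Φ.toFun b)) :=
    hgs'.comp Φ.smooth
  refine (dirDeriv_sub (hcs.mdifferentiableAt (by simp))
    (hgs.mdifferentiableAt (by simp)) w.1.2).symm.trans ?_
  refine Subbundle.dirDeriv_eq_zero_of_mem_tangent hw.2 (hcs.sub hgs) ?_
  have hcont : Continuous (Φ.restrict (Φ.mem_carrier hD)) :=
    Continuous.subtype_mk (Φ.smooth.continuous.comp continuous_subtype_val) _
  have hev : ∀ᶠ b : D.carrier in 𝓝 a, g' (Φ.toFun b) - g b = 0 := by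
    filter_upwards [hge, hcont.continuousAt.eventually hge'] with b h1 h2
    exact sub_eq_zero.2 (h2.symm.trans h1)
  -- The extensions agree only on `D` near `a`; this becomes an implication on a neighbourhood in
  -- `E`.
  rw [nhds_subtype, eventually_comap] at hev
  filter_upwards [hev] with b hb hbD using hb ⟨b, hbD⟩ rfl

end Dynamics

end LieAlgebroidMorphism

end TwoBundles

end

theorem mainTheorem6 {n n' : ℕ} {M M' : Type*}
    [TopologicalSpace M] [ChartedSpace (EuclideanSpace ℝ (Fin n)) M]
    [T2Space M] [IsManifold (𝓡 n) ∞ M]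
    [TopologicalSpace M'] [ChartedSpace (EuclideanSpace ℝ (Fin n')) M']
    [T2Space M'] [IsManifold (𝓡 n') ∞ M']
    {F F' : Type*} [NormedAddCommGroup F] [NormedSpace ℝ F] [FiniteDimensional ℝ F]
    [NormedAddCommGroup F'] [NormedSpace ℝ F'] [FiniteDimensional ℝ F']
    {E : M → Type*} [TopologicalSpace (TotalSpace F E)] [∀ x, TopologicalSpace (E x)]
    [FiberBundle F E] [∀ x, AddCommGroup (E x)] [∀ x, Module ℝ (E x)] [VectorBundle ℝ F E]
    [ContMDiffVectorBundle ∞ F E (𝓡 n)]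
    {E' : M' → Type*} [TopologicalSpace (TotalSpace F' E')] [∀ x, TopologicalSpace (E' x)]
    [FiberBundle F' E'] [∀ x, AddCommGroup (E' x)] [∀ x, Module ℝ (E' x)] [VectorBundle ℝ F' E']
    [ContMDiffVectorBundle ∞ F' E' (𝓡 n')]
    (A : LieAlgebroid n F E) (A' : LieAlgebroid n' F' E')
    (L : TotalSpace F E → ℝ) (hL : ContMDiff ((𝓡 n).prod 𝓘(ℝ, F)) 𝓘(ℝ, ℝ) ∞ L)
    (L' : TotalSpace F' E' → ℝ) (hL' : ContMDiff ((𝓡 n').prod 𝓘(ℝ, F')) 𝓘(ℝ, ℝ) ∞ L')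
    (D : Subbundle n F E) (D' : Subbundle n' F' E')
    (hreg : A.IsRegular L D)
    (Φ : LieAlgebroidMorphism A A')
    (hΦ : ∀ x, Function.Surjective (Φ.fiberMap x))
    (hLL' : ∀ a, L a = L' (Φ.toFun a))
    (hbase : Function.Surjective Φ.base)
    (hDD' : ∀ x, (D.fiber x).map (Φ.fiberMap x) = D'.fiber (Φ.base x)) :
    A'.IsRegular L' D' ∧
      ∀ (f' g' : D'.SmoothFunction) (a : D.carrier),
        A.nonholonomicBracket L D (Φ.pullback (Φ.mem_carrier hDD') f')
            (Φ.pullback (Φ.mem_carrier hDD') g') a =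
          A'.nonholonomicBracket L' D' f' g' (Φ.restrict (Φ.mem_carrier hDD') a) := by
  obtain rfl : L = fun c => L' (Φ.toFun c) := funext hLL'
  have hreg' := Φ.isRegular_of_comp hL' hΦ hDD' hreg hbase
  refine ⟨hreg', fun f' g' a => ?_⟩
  have hf := Φ.projector_hamiltonian_pullback hL' hΦ hDD' hreg hreg' f' a
  have hg := Φ.projector_hamiltonian_pullback hL' hΦ hDD' hreg hreg' g' a
  refine (Φ.cartanTwoForm_comp hL' hΦ _ _).trans ?_
  rw [← hf, ← hg]
  rfl
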